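/- **Setting.** Let $\mathbb X\subseteq\mathbb R$ be open with coordinate $x$, and let $G>0$. The canonical variables are fields $K_1,K_2,E^1,E^2$ on $\mathbb X$ with non-vanishing Poisson brackets $\{K_1(x),E^1(y)\}=2G\,\delta(x,y)$ and $\{K_2(x),E^2(y)\}=G\,\delta(x,y)$. Let $H_{\rm eff}$ and $\mu$ be smooth functions of the fields and finitely many of their $x$-derivatives, that is, of a jet ranging over an open set $U$ on which $E^1>0$, $E^2\neq0$ and $\mu\ne0$. The phase space $\mathcal P$ consists of all smooth fields on $\mathbb X$ whose jets lie in $U$ at every point. Write $F[N]=\int_{\mathbb X}F(x)N(x)\,dx$, $S=E^1/(E^2)^2$ and $H_x=\frac1{2G}(-K_1\partial_xE^1+2E^2\partial_xK_2)$. Assume that on all of $\mathcal P$, for all smooth compactly supported $N_1,N_2,N_1^x,N_2^x,N,M^x$ on $\mathbb X$, $$\{H_x[N^x_1],H_x[N^x_2]\}=H_x[N^x_1\partial_xN^x_2-N^x_2\partial_xN^x_1],\qquad \{H_{\rm eff}[N],H_x[M^x]\}=-H_{\rm eff}[M^x\partial_xN],$$ $$\{H_{\rm eff}[N_1],H_{\rm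 eff}[N_2]\}=H_x[\mu S(N_1\partial_xN_2-N_2\partial_xN_1)].$$ **Covariance.** All of $N,N^x,\alpha,\beta^x$ below are phase-space-independent smooth functions of $(t,x)$, with lapse $N>0$ and with $\alpha,\beta^x$ vanishing for $x$ outside some compact subset of $\mathbb X$. Evolution is generated by $H_{\rm eff}[N]+H_x[N^x]$. The effective metric is $$g^{(\mu)}=-N^2dt^2+\frac{(E^2)^2}{\mu E^1}(dx+N^xdt)^2+E^1(d\theta^2+\sin^2\theta\,d\phi^2).$$ Put $\mathfrak N=\partial_t-N^x\partial_x$, $\beta=\beta^x\partial_x$ and $\Gamma=H_{\rm eff}[\alpha N]+H_x[\beta^x]$. Under the gauge transformation generated by $\Gamma$ the fields vary by $\delta K_I=\{K_I,\Gamma\}$, $\delta E^I=\{E^I,\Gamma\}$. The lapse and shift vary by functions $\delta N,\delta N^x$, which may depend on the phase-space point, such that the transformed curves are the ones generated with lapse $N+\epsilon\,\delta N$ and shift $N^x+\epsilon\,\delta N^x$ to first order in $\epsilon$, i.e. such that on $\mathcal P$ $$H_{\rm eff}[\delta N]+H_x[\delta N^x]=\partial_t\Gamma+\{\Gamma,H_{\rm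 eff}[N]+H_x[N^x]\}.$$ The theory is *covariant with respect to $g^{(\mu)}$* if for all such $N,N^x,\alpha,\beta^x$ there are such $\delta N,\delta N^x$ with $$\delta g^{(\mu)}_{\rho\sigma}=\mathcal L_{\alpha\mathfrak N+\beta}\,g^{(\mu)}_{\rho\sigma}$$ at every point of $\mathcal P$ (not only where the constraints vanish), where first time derivatives of the fields are given by Hamilton's equations $\partial_tK_I=\{K_I,H_{\rm eff}[N]+H_x[N^x]\}$, $\partial_tE^I=\{E^I,H_{\rm eff}[N]+H_x[N^x]\}$. **Proposition.** The theory is covariant with respect to $g^{(\mu)}$ if and only if (i) $H_{\rm eff}$ is independent of $\partial_x^nK_1$ for all $n\ge1$, i.e. $\partial H_{\rm eff}/\partial(\partial_x^nK_1)=0$ on $\mathcal P$; and (ii) for all phase-space-independent smooth functions $\alpha,N$ on $\mathbb X$, everywhere on $\mathcal P$, $$\alpha\,\{\mu S,H_{\rm eff}[N]\}=\{\mu S,H_{\rm eff}[\alpha N]\}.$$ -/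

import Mathlib

open scoped ContDiff

noncomputable section

namespace SphSym

/-- The canonical variables: `Sum.inl I` is `K_{I+1}` and `Sum.inr I` is `E^{I+1}`, `I = 0, 1`. -/
abbrev Var := Fin 2 ⊕ Fin 2

abbrev K1 : Var := Sum.inl 0
abbrev K2 : Var := Sum.inl 1
abbrev E1 : Var := Sum.inr 0
abbrev E2 : Var := Sum.inr 1

/-- Field configurations on one time slice, as functions of the coordinate `x`. -/
abbrev Fields := Var → ℝ → ℝ

/-- Jets of order `k + 1`: the entry `(v, n)` is the value of `∂_x^n v`, `0 ≤ n ≤ k + 1`. -/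
abbrev Jet (k : ℕ) := Var → Fin (k + 2) → ℝ

/-- The jet of a configuration at `x`. -/
def jet (k : ℕ) (Z : Fields) (x : ℝ) : Jet k := fun v n => iteratedDeriv (n : ℕ) (Z v) x

/-- The partial derivative `∂f / ∂(∂_x^n v)` of a function of the jet. -/
def jetPartial {k : ℕ} (f : Jet k → ℝ) (v : Var) (n : Fin (k + 2)) (j : Jet k) : ℝ :=
  fderiv ℝ f j (Pi.single v (Pi.single n 1))

/-- The phase space: smooth fields on `X` all of whose jets lie in the domain `U`. -/
def phaseSpace {k : ℕ} (X : Set ℝ) (U : Set (Jet k)) : Set Fields :=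
  {Z | (∀ v, ContDiffOn ℝ ∞ (Z v) X) ∧ ∀ x ∈ X, jet k Z x ∈ U}

/-- Smearing functions: smooth, with compact support inside `X`. -/
def IsTest (X : Set ℝ) (f : ℝ → ℝ) : Prop :=
  ContDiff ℝ ∞ f ∧ HasCompactSupport f ∧ tsupport f ⊆ X

/-- The smeared functional `h[N] = ∫ h(x) N(x) dx`, where `h(x)` is a function of the jet at `x`. -/
def smear {k : ℕ} (X : Set ℝ) (h : Jet k → ℝ) (N : ℝ → ℝ) (Z : Fields) : ℝ :=
  ∫ x in X, h (jet k Z x) * N x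

/-- The variational derivative `δ h[N] / δ v(x) = ∑ₙ (-1)ⁿ ∂_xⁿ (N ∂h/∂(∂_xⁿ v))`. -/
def grad {k : ℕ} (h : Jet k → ℝ) (N : ℝ → ℝ) (Z : Fields) : Fields := fun v x =>
  ∑ n : Fin (k + 2),
    (-1 : ℝ) ^ (n : ℕ) * iteratedDeriv (n : ℕ) (fun y => N y * jetPartial h v n (jet k Z y)) x

/-- `{K_1(x), E^1(y)} = 2 G δ(x,y)` and `{K_2(x), E^2(y)} = G δ(x,y)`. -/
def coupling (G : ℝ) : Fin 2 → ℝ := ![2 * G, G]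

/-- The Poisson bracket `{A, B}` of two functionals, in terms of their variational derivatives
`a` and `b`. -/
def bracket (X : Set ℝ) (G : ℝ) (a b : Fields) : ℝ :=
  ∫ x in X, ∑ I : Fin 2, coupling G I *
    (a (Sum.inl I) x * b (Sum.inr I) x - a (Sum.inr I) x * b (Sum.inl I) x)

/-- The brackets `{v(x), A}` of the canonical variables with a functional whose variational
derivative is `a`. -/
def hamVF (G : ℝ) (a : Fields) : Fields
  | Sum.inl I => fun x => coupling G I * a (Sum.inr I) x
  | Sum.inr I => fun x => -(coupling G I * a (Sum.inl I) x)

/-- The bracket `{f(x), A}` of a function `f` of the jet at `x` with a functional whose variational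
derivative is `a`. -/
def localBracket {k : ℕ} (G : ℝ) (f : Jet k → ℝ) (a Z : Fields) (x : ℝ) : ℝ :=
  ∑ v : Var, ∑ n : Fin (k + 2),
    jetPartial f v n (jet k Z x) * iteratedDeriv (n : ℕ) (hamVF G a v) x

/-- The classical diffeomorphism constraint `(-K_1 ∂_x E^1 + 2 E^2 ∂_x K_2) / (2G)`. -/
def diffeo (k : ℕ) (G : ℝ) (j : Jet k) : ℝ :=
  1 / (2 * G) * (-(j K1 0 * j E1 1) + 2 * j E2 0 * j K2 1)

/-- The structure function `μ S = μ E^1 / (E^2)^2`. -/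
def muS {k : ℕ} (μ : Jet k → ℝ) (j : Jet k) : ℝ := μ j * (j E1 0 / j E2 0 ^ 2)

/-- The deformed constraint algebra, on the whole phase space. -/
def DeformedAlgebra {k : ℕ} (X : Set ℝ) (G : ℝ) (U : Set (Jet k)) (H μ : Jet k → ℝ) : Prop :=
  ∀ Z ∈ phaseSpace X U, ∀ N₁ N₂ : ℝ → ℝ, IsTest X N₁ → IsTest X N₂ →
    bracket X G (grad (diffeo k G) N₁ Z) (grad (diffeo k G) N₂ Z) =
      smear X (diffeo k G) (fun x => N₁ x * deriv N₂ x - N₂ x * deriv N₁ x) Z ∧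
    bracket X G (grad H N₁ Z) (grad (diffeo k G) N₂ Z) =
      -smear X H (fun x => N₂ x * deriv N₁ x) Z ∧
    bracket X G (grad H N₁ Z) (grad H N₂ Z) =
      smear X (diffeo k G)
        (fun x => muS μ (jet k Z x) * (N₁ x * deriv N₂ x - N₂ x * deriv N₁ x)) Z

/-- The variational derivative of the linear combination `H[N] + H_x[M]` of the constraints. -/
def totalGrad {k : ℕ} (G : ℝ) (H : Jet k → ℝ) (N M : ℝ → ℝ) (Z : Fields) : Fields :=
  grad H N Z + grad (diffeo k G) M Z

/-- The components, in the coordinates `(t, x, θ, φ)`, of the effective metric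
`-N² dt² + (E²)²/(μ E¹) (dx + Nˣ dt)² + E¹ (dθ² + sin² θ dφ²)`, for the configuration `Z` of a time
slice and the values `N`, `Nx` of lapse and shift at the point. -/
def metric {k : ℕ} (μ : Jet k → ℝ) (Z : Fields) (N Nx x θ : ℝ) : Matrix (Fin 4) (Fin 4) ℝ :=
  let q := (Z E2 x) ^ 2 / (μ (jet k Z x) * Z E1 x)
  !![-N ^ 2 + q * Nx ^ 2, q * Nx, 0, 0;
     q * Nx, q, 0, 0;
     0, 0, Z E1 x, 0;
     0, 0, 0, Z E1 x * Real.sin θ ^ 2]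

/-- The coordinate derivative `∂_κ f` on the 4-dimensional spacetime. -/
def pd (κ : Fin 4) (f : (Fin 4 → ℝ) → ℝ) (p : Fin 4 → ℝ) : ℝ :=
  deriv (fun s => f (Function.update p κ s)) (p κ)

/-- The Lie derivative `(L_V g)_{ρσ} = V^κ ∂_κ g_{ρσ} + g_{κσ} ∂_ρ V^κ + g_{ρκ} ∂_σ V^κ`. -/
def lieDeriv (V : (Fin 4 → ℝ) → Fin 4 → ℝ) (g : (Fin 4 → ℝ) → Matrix (Fin 4) (Fin 4) ℝ)
    (p : Fin 4 → ℝ) : Matrix (Fin 4) (Fin 4) ℝ := fun ρ σ =>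
  ∑ κ : Fin 4, (V p κ * pd κ (fun r => g r ρ σ) p + g p κ σ * pd ρ (fun r => V r κ) p +
    g p ρ κ * pd σ (fun r => V r κ) p)

/-- The spacetime vector field `α 𝔑 + β` with `𝔑 = ∂_t - Nˣ ∂_x` and `β = βˣ ∂_x`. -/
def gaugeVector (Nx α β : ℝ → ℝ → ℝ) (p : Fin 4 → ℝ) : Fin 4 → ℝ :=
  ![α (p 0) (p 1), -(α (p 0) (p 1) * Nx (p 0) (p 1)) + β (p 0) (p 1), 0, 0]

/-- Time-dependent functions `f t x` that are smooth on `ℝ × X`. -/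
def SmoothOn (X : Set ℝ) (f : ℝ → ℝ → ℝ) : Prop :=
  ContDiffOn ℝ ∞ (fun p : ℝ × ℝ => f p.1 p.2) (Set.univ ×ˢ X)

/-- Time-dependent smearing functions, with spatial support in a fixed compact subset of `X`. -/
def IsTimeTest (X : Set ℝ) (f : ℝ → ℝ → ℝ) : Prop :=
  ContDiff ℝ ∞ (fun p : ℝ × ℝ => f p.1 p.2) ∧
    ∃ C : Set ℝ, IsCompact C ∧ C ⊆ X ∧ ∀ t x, x ∉ C → f t x = 0

/-- The field history `Z` is smooth, and at the instant `t₀` it is in phase space and satisfies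
Hamilton's equations `∂_t v = {v, H[N] + H_x[Nˣ]}` with lapse `N` and shift `Nx`. -/
def SolvesAt {k : ℕ} (X : Set ℝ) (G : ℝ) (U : Set (Jet k)) (H : Jet k → ℝ) (N Nx : ℝ → ℝ → ℝ)
    (Z : ℝ → Fields) (t₀ : ℝ) : Prop :=
  (∀ v, SmoothOn X (fun t x => Z t v x)) ∧ Z t₀ ∈ phaseSpace X U ∧
    ∀ v, ∀ x ∈ X,
      HasDerivAt (fun t => Z t v x) (hamVF G (totalGrad G H (N t₀) (Nx t₀) (Z t₀)) v x) t₀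

/-- `δN` and `δNx` are the changes of lapse and shift under the gauge transformation generated by
`Γ = H[αN] + H_x[β]`.  The transformation turns the curves generated by `H[N] + H_x[Nˣ]` into the
curves generated by `H[N] + H_x[Nˣ] + ε (∂_t Γ + {Γ, H[N] + H_x[Nˣ]})`, to first order in `ε`.  These
solve Hamilton's equations for the new lapse `N + ε δN` and the new shift `Nˣ + ε δNˣ` when
`H[δN] + H_x[δNˣ] = ∂_t Γ + {Γ, H[N] + H_x[Nˣ]}` as functions on phase space.  Here `δN` and `δNx`
may depend on the point of phase space. -/
def IsMultiplierVariation {k : ℕ} (X : Set ℝ) (G : ℝ) (U : Set (Jet k)) (H : Jet k → ℝ)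
    (N Nx α β : ℝ → ℝ → ℝ) (δN δNx : Fields → ℝ → ℝ → ℝ) : Prop :=
  ∀ Z ∈ phaseSpace X U, ∀ t,
    IsTest X (δN Z t) ∧ IsTest X (δNx Z t) ∧
    smear X H (δN Z t) Z + smear X (diffeo k G) (δNx Z t) Z =
      smear X H (fun x => deriv (fun s => α s x * N s x) t) Z +
      smear X (diffeo k G) (fun x => deriv (fun s => β s x) t) Z +
      bracket X G (totalGrad G H (fun x => α t x * N t x) (β t) Z)
        (totalGrad G H (N t) (Nx t) Z)

/-- Covariance with respect to the effective metric: for all phase-space-independent lapse, shift,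
`α` and `β`, the gauge transformation of the metric generated by `H[αN] + H_x[β]` (the fields vary
by their Poisson brackets with the generator, lapse and shift as above) is the Lie derivative of the
metric along `α𝔑 + β`, the time derivatives being given by Hamilton's equations. -/
def Covariant {k : ℕ} (X : Set ℝ) (G : ℝ) (U : Set (Jet k)) (H μ : Jet k → ℝ) : Prop :=
  ∀ N Nx α β : ℝ → ℝ → ℝ, SmoothOn X N → (∀ t, ∀ x ∈ X, 0 < N t x) → SmoothOn X Nx →
    IsTimeTest X α → IsTimeTest X β →
    ∃ δN δNx : Fields → ℝ → ℝ → ℝ,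
      IsMultiplierVariation X G U H N Nx α β δN δNx ∧
      ∀ (Z : ℝ → Fields) (p : Fin 4 → ℝ), p 1 ∈ X → SolvesAt X G U H N Nx Z (p 0) →
        ∀ ρ σ : Fin 4,
          HasDerivAt
            (fun ε : ℝ =>
              metric μ
                (Z (p 0) + ε • hamVF G
                  (totalGrad G H (fun x => α (p 0) x * N (p 0) x) (β (p 0)) (Z (p 0))))
                (N (p 0) (p 1) + ε * δN (Z (p 0)) (p 0) (p 1))
                (Nx (p 0) (p 1) + ε * δNx (Z (p 0)) (p 0) (p 1)) (p 1) (p 2) ρ σ)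
            (lieDeriv (gaugeVector Nx α β)
              (fun r => metric μ (Z (r 0)) (N (r 0) (r 1)) (Nx (r 0) (r 1)) (r 1) (r 2)) p ρ σ)
            0

/-- `H` does not depend on `∂_x^n K_1` for `n ≥ 1`, along all configurations of phase space. -/
def IndepOfDerivK1 {k : ℕ} (X : Set ℝ) (U : Set (Jet k)) (H : Jet k → ℝ) : Prop :=
  ∀ Z ∈ phaseSpace X U, ∀ x ∈ X, ∀ n : Fin (k + 2), 1 ≤ (n : ℕ) →
    jetPartial H K1 n (jet k Z x) = 0

/-- `α {μS, H[N]} = {μS, H[αN]}` for all phase-space-independent functions `α` and `N`. -/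
def StructureFunctionCondition {k : ℕ} (X : Set ℝ) (G : ℝ) (U : Set (Jet k))
    (H μ : Jet k → ℝ) : Prop :=
  ∀ Z ∈ phaseSpace X U, ∀ α N : ℝ → ℝ, ContDiffOn ℝ ∞ α X → ContDiffOn ℝ ∞ N X →
    ∀ x ∈ X, α x * localBracket G (muS μ) (grad H N Z) Z x =
      localBracket G (muS μ) (grad H (fun y => α y * N y) Z) Z x

end SphSym

end

open scoped ContDiff
open Filter Topology MeasureTheory

noncomputable section

namespace SphSym

/-! ### Calculus on an open subset of the line: smearing functions, integration by parts, cutoffs.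
-/

variable {X : Set ℝ} {f g N : ℝ → ℝ}

/-! The effective metric is built from the lapse, the shift, `g_θθ = E¹` and `g_xx = 1/(μS)`.
Covariance therefore asks how these four quantities vary.

Lapse and shift. Expanding `∂_t Γ + {Γ, H[N] + H_x[Nˣ]}` with the constraint algebra exhibits
admissible `δN` and `δNˣ` (`bracket_totalGrad`). The shift variation contains `-μS N² ∂_x α`;
multiplied by `g_xx` it becomes the term `-N² ∂_x α` of the Lie derivative of `g_tx`. This is why
the structure function must be the inverse radial metric.

Spatial diffeomorphisms. `H_x[M]` moves the fields by their Lie derivative (`hamVF_grad_diffeo`), so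
`E¹` is a scalar. That `μS` moves like an inverse metric component is not assumed. It follows from
the Jacobi identity for two Hamiltonian constraints and one `H_x[M]`: differentiating `{H[N₁],
H[N₂]}` along the diffeomorphism in two ways gives `H_x` times the defect of the transformation law
equal to zero (`diffeo_mul_defect`). Where `H_x` vanishes, a small change of `∂_x K₂` makes it
nonzero, and continuity removes the factor (`fderiv_muS_lieFields`).

Normal deformations. What is left is that `H[αN]` must act on `E¹` and on `μS` as `α` times `H[N]`.
For `μS` this is condition (ii). For `E¹` it says that `δH[N]/δK₁` is multiplication of `N` by a
function, which holds when no derivative of `K₁` occurs; this gives sufficiency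
(`covariant_of_conditions`).

Conversely, taking zero shift, `β = 0` and static `α, N` reads both statements off the `θθ` and `xx`
components (`Covariant.static`). Choosing `α` with a zero of order `m` at a point then isolates the
coefficient of `∂_x^m K₁`, and descending induction on `m` yields (i) (`Covariant.indepOfDerivK1`).
Linearity in `N` removes the positivity of the lapse from (ii). -/

theorem _root_.ContDiffOn.contDiffAt_of_isOpen {E F : Type*} [NormedAddCommGroup E]
    [NormedSpace ℝ E] [NormedAddCommGroup F] [NormedSpace ℝ F] {f : E → F} {n : WithTop ℕ∞}
    {s : Set E} {x : E} (hf : ContDiffOn ℝ n f s) (hs : IsOpen s) (hx : x ∈ s) :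
    ContDiffAt ℝ n f x :=
  hf.contDiffAt (hs.mem_nhds hx)

theorem smooth_deriv (hX : IsOpen X) (hf : ContDiffOn ℝ ∞ f X) : ContDiffOn ℝ ∞ (deriv f) X :=
  hf.deriv_of_isOpen hX (by simp)

theorem smooth_iteratedDeriv (hX : IsOpen X) (hf : ContDiffOn ℝ ∞ f X) (n : ℕ) :
    ContDiffOn ℝ ∞ (iteratedDeriv n f) X := by
  induction n with
  | zero => simpa using hf
  | succ n ih => rw [iteratedDeriv_succ]; exact smooth_deriv hX ih

theorem hasDerivAt_of_smooth (hX : IsOpen X) (hf : ContDiffOn ℝ ∞ f X) {x : ℝ} (hx : x ∈ X) :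
    HasDerivAt f (deriv f x) x :=
  ((hf.contDiffAt_of_isOpen hX hx).differentiableAt (by simp)).hasDerivAt

theorem eventuallyEq_of_eqOn (hX : IsOpen X) (h : Set.EqOn f g X) {x : ℝ} (hx : x ∈ X) :
    f =ᶠ[𝓝 x] g :=
  h.eventuallyEq_of_mem (hX.mem_nhds hx)

theorem iteratedDeriv_congr_on (hX : IsOpen X) (h : Set.EqOn f g X) (n : ℕ) :
    Set.EqOn (iteratedDeriv n f) (iteratedDeriv n g) X := fun _ hx =>
  (eventuallyEq_of_eqOn hX h hx).iteratedDeriv_eq n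

theorem iteratedDeriv_eq_zero_of_notMem_tsupport {x : ℝ} (hx : x ∉ tsupport f) (n : ℕ) :
    iteratedDeriv n f x = 0 := by
  have h : f =ᶠ[𝓝 x] fun _ => 0 := notMem_tsupport_iff_eventuallyEq.1 hx
  rw [h.iteratedDeriv_eq n]
  simp

/-- A function that is smooth on the open set `X` and vanishes off a compact subset of `X` is a
smearing function. -/
theorem isTest_of_zero_off (hX : IsOpen X) {C : Set ℝ} (hC : IsCompact C) (hCX : C ⊆ X)
    (hf : ContDiffOn ℝ ∞ f X) (h0 : ∀ x, x ∉ C → f x = 0) : IsTest X f := by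
  have hs : tsupport f ⊆ C := closure_minimal
    (fun x hx => by by_contra h; exact hx (h0 x h)) hC.isClosed
  refine ⟨contDiff_iff_contDiffAt.2 fun x => ?_, hC.of_isClosed_subset (isClosed_tsupport f) hs,
    hs.trans hCX⟩
  by_cases hx : x ∈ X
  · exact hf.contDiffAt_of_isOpen hX hx
  · have : f =ᶠ[𝓝 x] fun _ => 0 := by
      filter_upwards [hC.isClosed.isOpen_compl.mem_nhds (fun h => hx (hCX h))] with y hy
      exact h0 y hy
    exact contDiffAt_const.congr_of_eventuallyEq this

namespace IsTest

theorem smooth (hN : IsTest X N) : ContDiffOn ℝ ∞ N X := hN.1.contDiffOn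

theorem eq_zero (hN : IsTest X N) {x : ℝ} (hx : x ∉ X) : N x = 0 :=
  image_eq_zero_of_notMem_tsupport fun h => hx (hN.2.2 h)

theorem mul_smooth (hX : IsOpen X) (hN : IsTest X N) (hf : ContDiffOn ℝ ∞ f X) :
    IsTest X fun x => N x * f x :=
  isTest_of_zero_off hX hN.2.1 hN.2.2 (hN.smooth.mul hf) fun x hx => by
    simp [image_eq_zero_of_notMem_tsupport hx]

theorem smooth_mul (hX : IsOpen X) (hN : IsTest X N) (hf : ContDiffOn ℝ ∞ f X) :
    IsTest X fun x => f x * N x := by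
  simpa only [mul_comm] using hN.mul_smooth hX hf

theorem add (hX : IsOpen X) (hf : IsTest X f) (hg : IsTest X g) : IsTest X fun x => f x + g x :=
  isTest_of_zero_off hX (IsCompact.union hf.2.1 hg.2.1) (Set.union_subset hf.2.2 hg.2.2)
    (hf.smooth.add hg.smooth) fun x hx => by
      simp only [Set.mem_union, not_or] at hx
      simp [image_eq_zero_of_notMem_tsupport hx.1, image_eq_zero_of_notMem_tsupport hx.2]

theorem const_mul (hX : IsOpen X) (hf : IsTest X f) (c : ℝ) : IsTest X fun x => c * f x :=
  hf.smooth_mul hX contDiffOn_const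

theorem neg (hX : IsOpen X) (hf : IsTest X f) : IsTest X fun x => - f x := by
  simpa using hf.const_mul hX (-1)

theorem sub (hX : IsOpen X) (hf : IsTest X f) (hg : IsTest X g) : IsTest X fun x => f x - g x := by
  simpa only [sub_eq_add_neg] using hf.add hX (hg.neg hX)

theorem deriv (hX : IsOpen X) (hf : IsTest X f) : IsTest X (deriv f) :=
  isTest_of_zero_off hX hf.2.1 hf.2.2 (smooth_deriv hX hf.smooth) fun x hx => by
    simpa using iteratedDeriv_eq_zero_of_notMem_tsupport hx 1

theorem iteratedDeriv (hX : IsOpen X) (hf : IsTest X f) (n : ℕ) :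
    IsTest X (iteratedDeriv n f) := by
  induction n with
  | zero => simpa using hf
  | succ n ih => rw [iteratedDeriv_succ]; exact ih.deriv hX

theorem zero : IsTest X fun _ => 0 :=
  ⟨contDiff_const, HasCompactSupport.zero, by simp [tsupport]⟩

theorem sum (hX : IsOpen X) {ι : Type*} (s : Finset ι) {F : ι → ℝ → ℝ}
    (hF : ∀ i ∈ s, IsTest X (F i)) : IsTest X fun x => ∑ i ∈ s, F i x := by
  classical
  induction s using Finset.induction_on with
  | empty => simpa using zero
  | insert a s ha ih =>
    simp only [Finset.sum_insert ha]
    exact (hF _ (by simp)).add hX (ih fun i hi => hF i (by simp [hi]))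

theorem integrable (hf : IsTest X f) : Integrable f := hf.1.continuous.integrable_of_hasCompactSupport hf.2.1

theorem integrableOn (hf : IsTest X f) : IntegrableOn f X := hf.integrable.integrableOn

theorem setIntegral_eq (hf : IsTest X f) : ∫ x in X, f x = ∫ x, f x :=
  setIntegral_eq_integral_of_forall_compl_eq_zero fun _ hx => hf.eq_zero hx

theorem integral_deriv (hX : IsOpen X) (hf : IsTest X f) : ∫ x in X, _root_.deriv f x = 0 := by
  rw [(hf.deriv hX).setIntegral_eq]
  exact integral_eq_zero_of_hasDerivAt_of_integrable
    (fun x => ((hf.1.differentiable (by simp)) x).hasDerivAt) (hf.deriv hX).integrable hf.integrable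

end IsTest

theorem integral_mul_deriv_of_isTest (hX : IsOpen X) (hN : IsTest X N) (hf : ContDiffOn ℝ ∞ f X) :
    ∫ x in X, N x * deriv f x = -∫ x in X, deriv N x * f x := by
  have h := (hN.mul_smooth hX hf).integral_deriv hX
  have h1 : ∀ x ∈ X, deriv (fun x => N x * f x) x = deriv N x * f x + N x * deriv f x := fun x hx =>
    ((hasDerivAt_of_smooth hX hN.smooth hx).mul (hasDerivAt_of_smooth hX hf hx)).deriv
  rw [setIntegral_congr_fun hX.measurableSet h1,
    integral_add ((hN.deriv hX).mul_smooth hX hf).integrableOn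
      (hN.mul_smooth hX (smooth_deriv hX hf)).integrableOn] at h
  linarith

theorem integral_iteratedDeriv_mul (hX : IsOpen X) (n : ℕ) : ∀ {N f : ℝ → ℝ}, IsTest X N →
    ContDiffOn ℝ ∞ f X → ∫ x in X, (-1) ^ n * iteratedDeriv n N x * f x =
      ∫ x in X, N x * iteratedDeriv n f x := by
  induction n with
  | zero => intros; simp
  | succ n ih =>
    intro N f hN hf
    have h1 := ih (hN.deriv hX) hf
    have h2 := integral_mul_deriv_of_isTest hX hN (smooth_iteratedDeriv hX hf n)
    rw [iteratedDeriv_succ' (f := N), iteratedDeriv_succ (f := f), h2, ← h1, ← integral_neg]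
    refine integral_congr_ae (ae_of_all _ fun x => ?_)
    simp only [pow_succ]; ring

/-- Testing gives vanishing almost everywhere, and continuity upgrades this to every point. All
smeared identities are made pointwise through this. -/
theorem eq_zero_of_forall_integral_isTest (hX : IsOpen X) (hf : ContDiffOn ℝ ∞ f X)
    (h : ∀ N, IsTest X N → ∫ x in X, N x * f x = 0) : ∀ x ∈ X, f x = 0 := by
  have h1 := hX.ae_eq_zero_of_integral_contDiff_smul_eq_zero (μ := volume)
    (hf.continuousOn.locallyIntegrableOn hX.measurableSet) fun N h1 h2 h3 => by
      have hN : IsTest X N := ⟨h1, h2, h3⟩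
      have := h N hN
      rw [(hN.mul_smooth hX hf).setIntegral_eq] at this
      simpa using this
  have h2 : f =ᵐ[volume.restrict X] fun _ => 0 := by
    rw [EventuallyEq, ae_restrict_iff' hX.measurableSet]; exact h1
  exact fun x hx => Measure.eqOn_open_of_ae_eq h2 hX hf.continuousOn continuousOn_const hx

theorem eqOn_of_forall_integral_isTest (hX : IsOpen X) (hf : ContDiffOn ℝ ∞ f X)
    (hg : ContDiffOn ℝ ∞ g X)
    (h : ∀ N, IsTest X N → ∫ x in X, N x * f x = ∫ x in X, N x * g x) : Set.EqOn f g X := by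
  intro x hx
  refine sub_eq_zero.1 (eq_zero_of_forall_integral_isTest hX (f := fun x => f x - g x)
    (hf.sub hg) (fun N hN => ?_) x hx)
  simp only [mul_sub]
  rw [integral_sub (hN.mul_smooth hX hf).integrableOn (hN.mul_smooth hX hg).integrableOn, h N hN,
    sub_self]

/-- Cutoff functions. -/
theorem exists_isTest_eventuallyEq_one (hX : IsOpen X) {C : Set ℝ} (hC : IsCompact C) (hCX : C ⊆ X) :
    ∃ χ, IsTest X χ ∧ ∀ x ∈ C, χ =ᶠ[𝓝 x] fun _ => 1 := by
  obtain ⟨K, hK, hCK, hKX⟩ := exists_compact_between hC hX hCX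
  obtain ⟨χ, h1, h0, -⟩ := exists_contMDiffMap_one_nhds_of_subset_interior (n := ⊤)
    (modelWithCornersSelf ℝ ℝ) hC.isClosed hCK
  refine ⟨χ, isTest_of_zero_off hX hK hKX χ.contMDiff.contDiff.contDiffOn h0, fun x hx => ?_⟩
  exact (eventually_nhdsSet_iff_forall.1 h1 x hx)

/-! ### Functions of two variables -/

section TwoVariables

variable {O : Set (ℝ × ℝ)} {F : ℝ → ℝ → ℝ}

theorem hasDerivAt_fst (hO : IsOpen O) (hF : ContDiffOn ℝ ∞ (fun p : ℝ × ℝ => F p.1 p.2) O)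
    {s x : ℝ} (h : (s, x) ∈ O) :
    HasDerivAt (fun s => F s x) (fderiv ℝ (fun p : ℝ × ℝ => F p.1 p.2) (s, x) (1, 0)) s := by
  have h1 := ((hF.contDiffAt_of_isOpen hO h).differentiableAt (by simp)).hasFDerivAt
  exact h1.comp_hasDerivAt s ((hasDerivAt_id s).prodMk (hasDerivAt_const s x))

theorem hasDerivAt_snd (hO : IsOpen O) (hF : ContDiffOn ℝ ∞ (fun p : ℝ × ℝ => F p.1 p.2) O)
    {s x : ℝ} (h : (s, x) ∈ O) :
    HasDerivAt (F s) (fderiv ℝ (fun p : ℝ × ℝ => F p.1 p.2) (s, x) (0, 1)) x := by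
  have h1 := ((hF.contDiffAt_of_isOpen hO h).differentiableAt (by simp)).hasFDerivAt
  exact h1.comp_hasDerivAt x ((hasDerivAt_const x s).prodMk (hasDerivAt_id x))

theorem smooth_fderiv_apply {E : Type*} [NormedAddCommGroup E] [NormedSpace ℝ E] {O : Set E}
    {f : E → ℝ} (hO : IsOpen O) (hf : ContDiffOn ℝ ∞ f O) (v : E) :
    ContDiffOn ℝ ∞ (fun p => fderiv ℝ f p v) O :=
  (hf.fderiv_of_isOpen hO (by simp)).clm_apply contDiffOn_const

theorem smooth_deriv_fst (hO : IsOpen O) (hF : ContDiffOn ℝ ∞ (fun p : ℝ × ℝ => F p.1 p.2) O) :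
    ContDiffOn ℝ ∞ (fun p : ℝ × ℝ => deriv (fun s => F s p.2) p.1) O :=
  (smooth_fderiv_apply hO hF (1, 0)).congr fun _ hp => (hasDerivAt_fst hO hF hp).deriv

theorem smooth_deriv_snd (hO : IsOpen O) (hF : ContDiffOn ℝ ∞ (fun p : ℝ × ℝ => F p.1 p.2) O) :
    ContDiffOn ℝ ∞ (fun p : ℝ × ℝ => deriv (F p.1) p.2) O :=
  (smooth_fderiv_apply hO hF (0, 1)).congr fun _ hp => (hasDerivAt_snd hO hF hp).deriv

theorem smooth_iteratedDeriv_snd (hO : IsOpen O)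
    (hF : ContDiffOn ℝ ∞ (fun p : ℝ × ℝ => F p.1 p.2) O) (n : ℕ) :
    ContDiffOn ℝ ∞ (fun p : ℝ × ℝ => iteratedDeriv n (F p.1) p.2) O := by
  induction n with
  | zero => simpa using hF
  | succ n ih =>
    simp only [iteratedDeriv_succ]
    exact smooth_deriv_snd (F := fun s => iteratedDeriv n (F s)) hO ih

theorem minSmoothness_two_le_infty : minSmoothness ℝ 2 ≤ ∞ := by
  rw [minSmoothness_of_isRCLikeNormedField]
  exact WithTop.coe_le_coe.2 (le_top : (2 : ℕ∞) ≤ ⊤)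

theorem deriv_deriv_comm (hO : IsOpen O) (hF : ContDiffOn ℝ ∞ (fun p : ℝ × ℝ => F p.1 p.2) O)
    {s x : ℝ} (h : (s, x) ∈ O) :
    deriv (fun s => deriv (F s) x) s = deriv (fun y => deriv (fun s => F s y) s) x := by
  have hA : ContDiffAt ℝ ∞ (fun p : ℝ × ℝ => F p.1 p.2) (s, x) := hF.contDiffAt_of_isOpen hO h
  have hd : DifferentiableAt ℝ (fderiv ℝ fun p : ℝ × ℝ => F p.1 p.2) (s, x) :=
    (hA.fderiv_right (m := ∞) (by simp)).differentiableAt (by simp)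
  have e1 : ∀ᶠ s' in 𝓝 s, deriv (F s') x =
      fderiv ℝ (fun p : ℝ × ℝ => F p.1 p.2) (s', x) (0, 1) := by
    have : ∀ᶠ s' in 𝓝 s, (s', x) ∈ O :=
      (by fun_prop : Continuous fun s' : ℝ => (s', x)).continuousAt.preimage_mem_nhds
        (hO.mem_nhds h)
    filter_upwards [this] with s' hs'
    exact (hasDerivAt_snd hO hF hs').deriv
  have e2 : ∀ᶠ y in 𝓝 x, deriv (fun s => F s y) s =
      fderiv ℝ (fun p : ℝ × ℝ => F p.1 p.2) (s, y) (1, 0) := by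
    have : ∀ᶠ y in 𝓝 x, (s, y) ∈ O :=
      (by fun_prop : Continuous fun y : ℝ => (s, y)).continuousAt.preimage_mem_nhds
        (hO.mem_nhds h)
    filter_upwards [this] with y hy
    exact (hasDerivAt_fst hO hF hy).deriv
  have e1' : deriv (fun s => deriv (F s) x) s = _ := EventuallyEq.deriv_eq e1
  have e2' : deriv (fun y => deriv (fun s => F s y) s) x = _ := EventuallyEq.deriv_eq e2
  have hsymm := hA.isSymmSndFDerivAt minSmoothness_two_le_infty
    (1, 0) (0, 1)
  rw [e1', e2']
  generalize fderiv ℝ (fun p : ℝ × ℝ => F p.1 p.2) = T at hd hsymm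
  have d1 : HasDerivAt (fun s' => T (s', x)) (fderiv ℝ T (s, x) (1, 0)) s :=
    hd.hasFDerivAt.comp_hasDerivAt s ((hasDerivAt_id s).prodMk (hasDerivAt_const s x))
  have d2 : HasDerivAt (fun y => T (s, y)) (fderiv ℝ T (s, x) (0, 1)) x :=
    hd.hasFDerivAt.comp_hasDerivAt x ((hasDerivAt_const x s).prodMk (hasDerivAt_id x))
  have d1' := d1.clm_apply (hasDerivAt_const s ((0 : ℝ), (1 : ℝ)))
  have d2' := d2.clm_apply (hasDerivAt_const x ((1 : ℝ), (0 : ℝ)))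
  rw [d1'.deriv, d2'.deriv, map_zero, add_zero, add_zero, hsymm]

/-- Induction with `∂_x F` in place of `F`; symmetry of the mixed second derivative moves `∂_s` past
one `∂_x` at each stage. -/
theorem hasDerivAt_iteratedDeriv_param (hO : IsOpen O) (n : ℕ) : ∀ {F : ℝ → ℝ → ℝ},
    ContDiffOn ℝ ∞ (fun p : ℝ × ℝ => F p.1 p.2) O → ∀ {s x : ℝ}, (s, x) ∈ O →
    HasDerivAt (fun s => iteratedDeriv n (F s) x)
      (iteratedDeriv n (fun y => deriv (fun s => F s y) s) x) s := by
  induction n with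
  | zero =>
    intro F hF s x h
    simpa using (hasDerivAt_fst hO hF h).differentiableAt.hasDerivAt
  | succ n ih =>
    intro F hF s x h
    have h1 := ih (F := fun s => deriv (F s)) (smooth_deriv_snd hO hF) h
    have e : (fun y => deriv (fun s => deriv (F s) y) s) =ᶠ[𝓝 x]
        deriv (fun y => deriv (fun s => F s y) s) := by
      have : ∀ᶠ y in 𝓝 x, (s, y) ∈ O :=
        (by fun_prop : Continuous fun y : ℝ => (s, y)).continuousAt.preimage_mem_nhds
          (hO.mem_nhds h)
      filter_upwards [this] with y hy
      exact deriv_deriv_comm hO hF hy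
    simp only [iteratedDeriv_succ']
    rwa [e.iteratedDeriv_eq n] at h1

/-- A support `K` common to all parameters supplies the domination: the parameter derivative is
continuous, hence bounded, on the compact product of a half-radius closed ball with `K`. -/
theorem hasDerivAt_integral_param {ε : ℝ} (hε : 0 < ε) (hX : IsOpen X) {K : Set ℝ}
    (hK : IsCompact K) (hKX : K ⊆ X)
    (hF : ContDiffOn ℝ ∞ (fun p : ℝ × ℝ => F p.1 p.2) (Metric.ball 0 ε ×ˢ X))
    (h0 : ∀ s, ∀ x, x ∉ K → F s x = 0) :
    HasDerivAt (fun s => ∫ x in X, F s x) (∫ x in X, deriv (fun s => F s x) 0) 0 := by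
  have hO : IsOpen (Metric.ball (0 : ℝ) ε ×ˢ X) := Metric.isOpen_ball.prod hX
  have hslice : ∀ s ∈ Metric.ball (0 : ℝ) ε, IsTest X (F s) := fun s hs =>
    isTest_of_zero_off hX hK hKX
      (hF.comp (f := fun x : ℝ => (s, x)) (by fun_prop) fun x hx => ⟨hs, hx⟩) (h0 s)
  have hd0 : ∀ s, ∀ x, x ∉ K → deriv (fun s => F s x) s = 0 := fun s x hx => by
    simp [h0 _ x hx]
  have hF' := smooth_deriv_fst hO hF
  have hslice' : ∀ s ∈ Metric.ball (0 : ℝ) ε, IsTest X (fun x => deriv (fun s => F s x) s) :=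
    fun s hs => isTest_of_zero_off hX hK hKX
      (hF'.comp (f := fun x : ℝ => (s, x)) (by fun_prop) fun x hx => ⟨hs, hx⟩) (hd0 s)
  have hsub : Metric.closedBall (0 : ℝ) (ε / 2) ×ˢ K ⊆ Metric.ball 0 ε ×ˢ X :=
    Set.prod_mono (Metric.closedBall_subset_ball (by linarith)) hKX
  obtain ⟨C, hC⟩ := ((isCompact_closedBall (0 : ℝ) (ε / 2)).prod hK).exists_bound_of_continuousOn
    (hF'.continuousOn.mono hsub)
  refine (hasDerivAt_integral_of_dominated_loc_of_deriv_le
    (F' := fun s x => deriv (fun s => F s x) s) (bound := K.indicator fun _ => C)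
    (Metric.ball_mem_nhds (0 : ℝ) (half_pos hε)) ?_ ?_ ?_ ?_ ?_ ?_).2
  · filter_upwards [Metric.ball_mem_nhds (0 : ℝ) hε] with s hs
    exact (hslice s hs).1.continuous.aestronglyMeasurable
  · exact (hslice 0 (Metric.mem_ball_self hε)).integrableOn
  · exact (hslice' 0 (Metric.mem_ball_self hε)).1.continuous.aestronglyMeasurable
  · refine ae_of_all _ fun x s hs => ?_
    by_cases hx : x ∈ K
    · rw [Set.indicator_of_mem hx]
      exact hC (s, x) ⟨Metric.ball_subset_closedBall hs, hx⟩
    · simp only [hd0 s x hx, norm_zero, Set.indicator_of_notMem hx, le_refl]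
  · exact ((integrableOn_const hK.measure_lt_top.ne).integrable_indicator hK.measurableSet).integrableOn
  · refine ae_of_all _ fun x s hs => ?_
    by_cases hx : x ∈ K
    · exact (hasDerivAt_fst hO hF (hsub ⟨Metric.ball_subset_closedBall hs, hx⟩)).differentiableAt.hasDerivAt
    · simp only [h0 _ x hx, deriv_const]
      exact hasDerivAt_const _ _

end TwoVariables

/-! ### Jets of fields -/

section Jets

variable {k : ℕ} {X : Set ℝ} {U : Set (Jet k)} {f : Jet k → ℝ} {Z B : Fields} {x : ℝ}

/-- All fields are smooth on `X`. -/
def SmoothFields (X : Set ℝ) (Z : Fields) : Prop := ∀ v, ContDiffOn ℝ ∞ (Z v) X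

/-- The fields `∂_x v`. -/
def derivFields (Z : Fields) : Fields := fun v => deriv (Z v)

theorem SmoothFields.derivFields (hX : IsOpen X) (hZ : SmoothFields X Z) :
    SmoothFields X (derivFields Z) := fun v => smooth_deriv hX (hZ v)

theorem SmoothFields.add_smul (hZ : SmoothFields X Z) (hB : SmoothFields X B) (s : ℝ) :
    SmoothFields X (Z + s • B) := fun v => (hZ v).add (contDiffOn_const.mul (hB v))

theorem jet_add_smul (hX : IsOpen X) (hZ : SmoothFields X Z) (hB : SmoothFields X B) (s : ℝ)
    (hx : x ∈ X) : jet k (Z + s • B) x = jet k Z x + s • jet k B x := by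
  funext v n
  have h1 : ContDiffAt ℝ ((n : ℕ) : ℕ∞) (Z v) x :=
    ((hZ v).contDiffAt_of_isOpen hX hx).of_le (by exact_mod_cast le_top)
  have h2 : ContDiffAt ℝ ((n : ℕ) : ℕ∞) (B v) x :=
    ((hB v).contDiffAt_of_isOpen hX hx).of_le (by exact_mod_cast le_top)
  have h3 : (Z + s • B) v = Z v + s • B v := rfl
  simp only [jet, h3, Pi.add_apply, Pi.smul_apply]
  rw [iteratedDeriv_add h1 (by simpa [Pi.smul_def] using h2.const_smul s), iteratedDeriv_const_smul h2 s]

theorem jet_congr (hX : IsOpen X) (h : ∀ v, Set.EqOn (Z v) (B v) X) (hx : x ∈ X) :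
    jet k Z x = jet k B x := by
  funext v n
  exact iteratedDeriv_congr_on hX (h v) n hx

theorem smooth_jet (hX : IsOpen X) (hZ : SmoothFields X Z) : ContDiffOn ℝ ∞ (jet k Z) X :=
  contDiffOn_pi.2 fun v => contDiffOn_pi.2 fun n => smooth_iteratedDeriv hX (hZ v) n

theorem hasDerivAt_jet (hX : IsOpen X) (hZ : SmoothFields X Z) (hx : x ∈ X) :
    HasDerivAt (jet k Z) (jet k (derivFields Z) x) x := by
  refine hasDerivAt_pi.2 fun v => hasDerivAt_pi.2 fun n => ?_
  have h := hasDerivAt_of_smooth hX (smooth_iteratedDeriv hX (hZ v) n) hx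
  rwa [← iteratedDeriv_succ, iteratedDeriv_succ'] at h

theorem smooth_comp_jet (hX : IsOpen X) (hf : ContDiffOn ℝ ∞ f U) (hZ : Z ∈ phaseSpace X U) :
    ContDiffOn ℝ ∞ (fun x => f (jet k Z x)) X :=
  hf.comp (smooth_jet hX hZ.1) hZ.2

theorem hasFDerivAt_of_smooth (hU : IsOpen U) (hf : ContDiffOn ℝ ∞ f U) {j : Jet k} (hj : j ∈ U) :
    HasFDerivAt f (fderiv ℝ f j) j :=
  ((hf.contDiffAt_of_isOpen hU hj).differentiableAt (by simp)).hasFDerivAt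

theorem hasDerivAt_comp_jet (hX : IsOpen X) (hU : IsOpen U) (hf : ContDiffOn ℝ ∞ f U)
    (hZ : Z ∈ phaseSpace X U) (hx : x ∈ X) :
    HasDerivAt (fun x => f (jet k Z x)) (fderiv ℝ f (jet k Z x) (jet k (derivFields Z) x)) x :=
  (hasFDerivAt_of_smooth hU hf (hZ.2 x hx)).comp_hasDerivAt x (hasDerivAt_jet hX hZ.1 hx)

theorem smooth_jetPartial (hU : IsOpen U) (hf : ContDiffOn ℝ ∞ f U) (v : Var) (n : Fin (k + 2)) :
    ContDiffOn ℝ ∞ (jetPartial f v n) U :=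
  smooth_fderiv_apply hU hf _

theorem sum_single_single (w : Jet k) :
    ∑ v : Var, ∑ n : Fin (k + 2), w v n • (Pi.single v (Pi.single n 1) : Jet k) = w := by
  funext v n
  simp only [Finset.sum_apply, Pi.smul_apply, smul_eq_mul]
  rw [Finset.sum_eq_single v, Finset.sum_eq_single n]
  · simp
  · intro m _ hm
    simp [hm.symm]
  · simp
  · intro v' _ hv
    simp [hv.symm]
  · simp

theorem continuousLinearMap_apply_jet (T : Jet k →L[ℝ] ℝ) (w : Jet k) :
    T w = ∑ v : Var, ∑ n : Fin (k + 2), T (Pi.single v (Pi.single n 1)) * w v n := by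
  conv_lhs => rw [← sum_single_single w]
  simp only [map_sum, map_smul, smul_eq_mul, mul_comm]

theorem fderiv_apply_eq_sum (f : Jet k → ℝ) (j w : Jet k) :
    fderiv ℝ f j w = ∑ v : Var, ∑ n : Fin (k + 2), jetPartial f v n j * w v n :=
  continuousLinearMap_apply_jet _ _

/-- A local bracket is the directional derivative along the jet of the Hamiltonian vector field, so
linearity and the chain rule become available. -/
theorem localBracket_eq_fderiv (G : ℝ) (f : Jet k → ℝ) (a Z : Fields) (x : ℝ) :
    localBracket G f a Z x = fderiv ℝ f (jet k Z x) (jet k (hamVF G a) x) :=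
  (fderiv_apply_eq_sum _ _ _).symm

/-- The jet of a time-dependent field depends smoothly on both variables. -/
theorem smooth_jet_history {O : Set (ℝ × ℝ)} (hO : IsOpen O) {Z : ℝ → Fields}
    (hZ : ∀ v, ContDiffOn ℝ ∞ (fun p : ℝ × ℝ => Z p.1 v p.2) O) :
    ContDiffOn ℝ ∞ (fun p : ℝ × ℝ => jet k (Z p.1) p.2) O :=
  contDiffOn_pi.2 fun v => contDiffOn_pi.2 fun n =>
    smooth_iteratedDeriv_snd (F := fun s => Z s v) hO (hZ v) n

theorem hasDerivAt_jet_history {O : Set (ℝ × ℝ)} (hO : IsOpen O) {Z : ℝ → Fields}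
    (hZ : ∀ v, ContDiffOn ℝ ∞ (fun p : ℝ × ℝ => Z p.1 v p.2) O) {s : ℝ} (h : (s, x) ∈ O) :
    HasDerivAt (fun s => jet k (Z s) x) (jet k (fun v y => deriv (fun s => Z s v y) s) x) s :=
  hasDerivAt_pi.2 fun v => hasDerivAt_pi.2 fun n =>
    hasDerivAt_iteratedDeriv_param hO n (F := fun s => Z s v) (hZ v) h

end Jets

/-! ### Variational derivatives and brackets -/

section Grad

variable {k : ℕ} {X : Set ℝ} {U : Set (Jet k)} {f : Jet k → ℝ} {Z w : Fields} {N : ℝ → ℝ}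
  {P : Var → Fin (k + 2) → ℝ → ℝ} {G : ℝ}

/-- The formal adjoint `∑ₙ (-1)ⁿ ∂_xⁿ (N P_{v,n})` of a linear differential operator. -/
def adjointOp (P : Var → Fin (k + 2) → ℝ → ℝ) (N : ℝ → ℝ) : Fields := fun v x =>
  ∑ n : Fin (k + 2), (-1 : ℝ) ^ (n : ℕ) * iteratedDeriv (n : ℕ) (fun y => N y * P v n y) x

theorem isTest_adjointOp (hX : IsOpen X) (hP : ∀ v n, ContDiffOn ℝ ∞ (P v n) X)
    (hN : IsTest X N) (v : Var) : IsTest X (adjointOp P N v) :=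
  IsTest.sum hX _ fun n _ => ((hN.mul_smooth hX (hP v n)).iteratedDeriv hX n).const_mul hX _

theorem smooth_adjointOp (hX : IsOpen X) (hP : ∀ v n, ContDiffOn ℝ ∞ (P v n) X)
    (hN : ContDiffOn ℝ ∞ N X) : SmoothFields X (adjointOp P N) := fun v =>
  ContDiffOn.sum fun n _ => contDiffOn_const.mul (smooth_iteratedDeriv hX (hN.mul (hP v n)) n)

/-- Repeated integration by parts; compact support of `N` kills the boundary terms, so `w` need only
be smooth. It serves both for the first variation `grad` and for the second variation `gradVar`,
which differ only in the coefficients `P`. -/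
theorem integral_adjointOp (hX : IsOpen X) (hP : ∀ v n, ContDiffOn ℝ ∞ (P v n) X)
    (hN : IsTest X N) (hw : SmoothFields X w) :
    ∫ x in X, ∑ v, adjointOp P N v x * w v x =
      ∫ x in X, N x * ∑ v, ∑ n : Fin (k + 2), P v n x * iteratedDeriv (n : ℕ) (w v) x := by
  have h1 : ∀ v (n : Fin (k + 2)), IsTest X fun x =>
      (-1 : ℝ) ^ (n : ℕ) * iteratedDeriv (n : ℕ) (fun y => N y * P v n y) x * w v x := fun v n =>
    (((hN.mul_smooth hX (hP v n)).iteratedDeriv hX n).const_mul hX _).mul_smooth hX (hw v)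
  have h2 : ∀ v (n : Fin (k + 2)), IsTest X fun x =>
      N x * P v n x * iteratedDeriv (n : ℕ) (w v) x := fun v n =>
    (hN.mul_smooth hX (hP v n)).mul_smooth hX (smooth_iteratedDeriv hX (hw v) n)
  simp only [adjointOp, Finset.sum_mul, Finset.mul_sum, ← mul_assoc]
  rw [integral_finsetSum _ fun v _ => (IsTest.sum hX _ fun n _ => h1 v n).integrableOn,
    integral_finsetSum _ fun v _ => (IsTest.sum hX _ fun n _ => h2 v n).integrableOn]
  refine Finset.sum_congr rfl fun v _ => ?_
  rw [integral_finsetSum _ fun n _ => (h1 v n).integrableOn,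
    integral_finsetSum _ fun n _ => (h2 v n).integrableOn]
  exact Finset.sum_congr rfl fun n _ =>
    integral_iteratedDeriv_mul hX n (hN.mul_smooth hX (hP v n)) (hw v)

theorem smooth_jetPartial_comp (hX : IsOpen X) (hU : IsOpen U) (hf : ContDiffOn ℝ ∞ f U)
    (hZ : Z ∈ phaseSpace X U) (v : Var) (n : Fin (k + 2)) :
    ContDiffOn ℝ ∞ (fun x => jetPartial f v n (jet k Z x)) X :=
  smooth_comp_jet hX (smooth_jetPartial hU hf v n) hZ

theorem isTest_grad (hX : IsOpen X) (hU : IsOpen U) (hf : ContDiffOn ℝ ∞ f U)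
    (hZ : Z ∈ phaseSpace X U) (hN : IsTest X N) (v : Var) : IsTest X (grad f N Z v) :=
  isTest_adjointOp hX (smooth_jetPartial_comp hX hU hf hZ) hN v

theorem smooth_grad (hX : IsOpen X) (hU : IsOpen U) (hf : ContDiffOn ℝ ∞ f U)
    (hZ : Z ∈ phaseSpace X U) (hN : ContDiffOn ℝ ∞ N X) : SmoothFields X (grad f N Z) :=
  smooth_adjointOp hX (smooth_jetPartial_comp hX hU hf hZ) hN

theorem integral_grad (hX : IsOpen X) (hU : IsOpen U) (hf : ContDiffOn ℝ ∞ f U)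
    (hZ : Z ∈ phaseSpace X U) (hN : IsTest X N) (hw : SmoothFields X w) :
    ∫ x in X, ∑ v, grad f N Z v x * w v x =
      ∫ x in X, N x * fderiv ℝ f (jet k Z x) (jet k w x) := by
  simp only [fderiv_apply_eq_sum]
  exact integral_adjointOp hX (smooth_jetPartial_comp hX hU hf hZ) hN hw

theorem grad_congr {M : ℝ → ℝ} {x : ℝ} (h : N =ᶠ[𝓝 x] M) (v : Var) :
    grad f N Z v x = grad f M Z v x := by
  refine Finset.sum_congr rfl fun n _ => ?_
  rw [EventuallyEq.iteratedDeriv_eq]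
  filter_upwards [h] with y hy
  rw [hy]

theorem grad_eq_zero {x : ℝ} (h : N =ᶠ[𝓝 x] fun _ => 0) (v : Var) : grad f N Z v x = 0 := by
  rw [grad_congr h]
  simp [grad]

theorem grad_add (hX : IsOpen X) (hU : IsOpen U) (hf : ContDiffOn ℝ ∞ f U)
    (hZ : Z ∈ phaseSpace X U) {M : ℝ → ℝ} (hN : ContDiffOn ℝ ∞ N X) (hM : ContDiffOn ℝ ∞ M X)
    (v : Var) {x : ℝ} (hx : x ∈ X) :
    grad f (fun x => N x + M x) Z v x = grad f N Z v x + grad f M Z v x := by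
  simp only [grad, ← Finset.sum_add_distrib, add_mul]
  refine Finset.sum_congr rfl fun n _ => ?_
  have hP := smooth_jetPartial_comp hX hU hf hZ v n
  rw [iteratedDeriv_fun_add, mul_add]
  · exact ((hN.mul hP).contDiffAt_of_isOpen hX hx).of_le (by exact_mod_cast le_top)
  · exact ((hM.mul hP).contDiffAt_of_isOpen hX hx).of_le (by exact_mod_cast le_top)

theorem isTest_hamVF (hX : IsOpen X) {a : Fields} (ha : ∀ v, IsTest X (a v)) (v : Var) :
    IsTest X (hamVF G a v) := by
  cases v with
  | inl I => exact (ha _).const_mul hX _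
  | inr I => exact ((ha _).const_mul hX _).neg hX

theorem smooth_hamVF {a : Fields} (ha : SmoothFields X a) : SmoothFields X (hamVF G a) := by
  intro v
  cases v with
  | inl I => exact contDiffOn_const.mul (ha _)
  | inr I => exact (contDiffOn_const.mul (ha _)).neg

/-- The signs in `hamVF` are such that `{A, B}` is the derivative of `A` along the Hamiltonian
vector field of `B`. -/
theorem bracket_integrand (a b : Fields) (x : ℝ) :
    (∑ I : Fin 2, coupling G I * (a (Sum.inl I) x * b (Sum.inr I) x - a (Sum.inr I) x *
      b (Sum.inl I) x)) = ∑ v, a v x * hamVF G b v x := by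
  rw [Fintype.sum_sum_type, ← Finset.sum_add_distrib]
  exact Finset.sum_congr rfl fun I _ => by simp only [hamVF]; ring

theorem bracket_eq (a b : Fields) :
    bracket X G a b = ∫ x in X, ∑ v, a v x * hamVF G b v x := by
  simp only [bracket, bracket_integrand]

theorem bracket_swap (a b : Fields) : bracket X G a b = -bracket X G b a := by
  rw [bracket, bracket, ← integral_neg]
  refine integral_congr_ae (ae_of_all _ fun x => ?_)
  simp only [← Finset.sum_neg_distrib]
  exact Finset.sum_congr rfl fun I _ => by ring

theorem bracket_grad (hX : IsOpen X) (hU : IsOpen U) (hf : ContDiffOn ℝ ∞ f U)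
    (hZ : Z ∈ phaseSpace X U) (hN : IsTest X N) {b : Fields} (hb : SmoothFields X b) :
    bracket X G (grad f N Z) b =
      ∫ x in X, N x * fderiv ℝ f (jet k Z x) (jet k (hamVF G b) x) := by
  rw [bracket_eq, integral_grad hX hU hf hZ hN (smooth_hamVF hb)]

theorem bracket_add_left (hX : IsOpen X) {a a' b : Fields} (ha : ∀ v, IsTest X (a v))
    (ha' : ∀ v, IsTest X (a' v)) (hb : SmoothFields X b) :
    bracket X G (a + a') b = bracket X G a b + bracket X G a' b := by
  have h : ∀ {a : Fields}, (∀ v, IsTest X (a v)) → IsTest X fun x => ∑ v, a v x * hamVF G b v x :=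
    fun h => IsTest.sum hX _ fun v _ => (h v).mul_smooth hX (smooth_hamVF hb v)
  rw [bracket_eq, bracket_eq, bracket_eq, ← integral_add (h ha).integrableOn (h ha').integrableOn]
  simp only [Pi.add_apply, add_mul, Finset.sum_add_distrib]

/-- Perturbations of compact support do not leave the phase space. -/
theorem eventually_add_smul_mem_phaseSpace (hX : IsOpen X) (hU : IsOpen U)
    (hZ : Z ∈ phaseSpace X U) (hw : ∀ v, IsTest X (w v)) :
    ∀ᶠ s : ℝ in 𝓝 0, Z + s • w ∈ phaseSpace X U := by
  set K : Set ℝ := ⋃ v, tsupport (w v)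
  have hK : IsCompact K := isCompact_iUnion fun v => (hw v).2.1
  have hKX : K ⊆ X := Set.iUnion_subset fun v => (hw v).2.2
  have hwS : SmoothFields X w := fun v => (hw v).smooth
  have hc : ∀ x ∈ K, ∀ᶠ z : ℝ × ℝ in 𝓝 (0, x), jet k Z z.2 + z.1 • jet k w z.2 ∈ U := by
    intro x hx
    have h1 : ContinuousAt (jet k Z) x :=
      ((smooth_jet hX hZ.1).contDiffAt_of_isOpen hX (hKX hx)).continuousAt
    have h2 : ContinuousAt (jet k w) x :=
      ((smooth_jet hX hwS).contDiffAt_of_isOpen hX (hKX hx)).continuousAt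
    have h3 : ContinuousAt (fun z : ℝ × ℝ => jet k Z z.2 + z.1 • jet k w z.2) (0, x) :=
      (h1.comp_of_eq continuousAt_snd rfl).add
        (continuousAt_fst.smul (h2.comp_of_eq continuousAt_snd rfl))
    exact h3.preimage_mem_nhds (hU.mem_nhds (by simpa using hZ.2 x (hKX hx)))
  -- Tube lemma over the compact union of supports: one range of `s` works for all points of `K`.
  -- Off `K` the jet is unchanged.
  filter_upwards [hK.eventually_forall_of_forall_eventually
    (P := fun s x => jet k Z x + s • jet k w x ∈ U) hc] with s hs
  refine ⟨SmoothFields.add_smul hZ.1 hwS s, fun x hx => ?_⟩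
  rw [jet_add_smul hX hZ.1 hwS s hx]
  by_cases hxK : x ∈ K
  · exact hs x hxK
  · have : jet k w x = 0 := by
      funext v n
      exact iteratedDeriv_eq_zero_of_notMem_tsupport
        (fun h => hxK (Set.mem_iUnion.2 ⟨v, h⟩)) n
    simpa [this] using hZ.2 x hx

end Grad

/-! ### The diffeomorphism constraint -/

section Diffeo

variable {k : ℕ} {X : Set ℝ} {U : Set (Jet k)} {Z B : Fields} {M : ℝ → ℝ} {G : ℝ}

/-- The Lie derivative of the fields along `M ∂_x`: `E¹` and `K_2` are scalars, `K_1` and `E²` are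
densities of weight one. -/
def lieFields (M : ℝ → ℝ) (Z : Fields) : Fields
  | Sum.inl 0 => deriv fun x => M x * Z K1 x
  | Sum.inl 1 => fun x => M x * deriv (Z K2) x
  | Sum.inr 0 => fun x => M x * deriv (Z E1) x
  | Sum.inr 1 => deriv fun x => M x * Z E2 x

theorem isTest_lieFields (hX : IsOpen X) (hM : IsTest X M) (hZ : SmoothFields X Z) (v : Var) :
    IsTest X (lieFields M Z v) := by
  match v with
  | Sum.inl 0 => exact (hM.mul_smooth hX (hZ _)).deriv hX
  | Sum.inl 1 => exact hM.mul_smooth hX (smooth_deriv hX (hZ _))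
  | Sum.inr 0 => exact hM.mul_smooth hX (smooth_deriv hX (hZ _))
  | Sum.inr 1 => exact (hM.mul_smooth hX (hZ _)).deriv hX

theorem contDiff_diffeo (k : ℕ) (G : ℝ) : ContDiff ℝ ∞ (diffeo k G) := by
  unfold diffeo; fun_prop

/-- The coordinate `∂_x^n v` of a jet. -/
def jetCoord (v : Var) (n : Fin (k + 2)) : Jet k →L[ℝ] ℝ :=
  (ContinuousLinearMap.proj (R := ℝ) (φ := fun _ : Fin (k + 2) => ℝ) n).comp
    (ContinuousLinearMap.proj (R := ℝ) (φ := fun _ : Var => Fin (k + 2) → ℝ) v)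

theorem jetPartial_diffeo (v : Var) (n : Fin (k + 2)) (j : Jet k) :
    jetPartial (diffeo k G) v n j = 1 / (2 * G) *
      (-((Pi.single v (Pi.single n 1) : Jet k) K1 0 * j E1 1 +
        j K1 0 * (Pi.single v (Pi.single n 1) : Jet k) E1 1) +
       2 * ((Pi.single v (Pi.single n 1) : Jet k) E2 0 * j K2 1 +
        j E2 0 * (Pi.single v (Pi.single n 1) : Jet k) K2 1)) := by
  have hp : ∀ (v : Var) (n : Fin (k + 2)), HasFDerivAt (fun j : Jet k => j v n)
      (jetCoord v n) j := fun v n => (jetCoord v n).hasFDerivAt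
  have h := ((((hp K1 0).mul (hp E1 1)).neg).add (((hp E2 0).const_mul 2).mul (hp K2 1))).const_mul
    (1 / (2 * G))
  have h' : fderiv ℝ (diffeo k G) j = _ := h.fderiv
  rw [jetPartial, h']
  simp only [jetCoord, smul_apply, add_apply,
    neg_apply, ContinuousLinearMap.comp_apply, ContinuousLinearMap.proj_apply,
    smul_eq_mul]
  ring

theorem sum_fin_eq_two {k : ℕ} (F : Fin (k + 2) → ℝ) (h : ∀ n : Fin k, F n.succ.succ = 0) :
    ∑ n, F n = F 0 + F 1 := by
  rw [Fin.sum_univ_succ, Fin.sum_univ_succ, Finset.sum_eq_zero fun n _ => h n, add_zero]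
  rfl

/-- Each field enters the constraint at a single order (`K₁` and `E²` undifferentiated, `E¹` and
`K₂` once), so one term of each variational derivative survives, and the couplings cancel the
prefactor `1/(2G)`. -/
theorem hamVF_grad_diffeo (k : ℕ) (hG : G ≠ 0) (Z : Fields) (M : ℝ → ℝ) :
    hamVF G (grad (diffeo k G) M Z) = lieFields M Z := by
  funext v x
  have hc : ∀ (v : Var) (c : ℝ), deriv (fun y => M y * (c * Z v y)) x =
      c * deriv (fun y => M y * Z v y) x := fun v c => by
    rw [← deriv_const_mul_field]; congr 1; funext y; ring
  have h01 : (0 : Fin (k + 2)) ≠ 1 := by simp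
  have hs0 : ∀ n : Fin k, (0 : Fin (k + 2)) ≠ n.succ.succ := fun n => (Fin.succ_ne_zero _).symm
  have hs1 : ∀ n : Fin k, (1 : Fin (k + 2)) ≠ n.succ.succ := fun n h => by
    have := congrArg Fin.val h; simp at this
  have hj0 : ∀ (v : Var) y, jet k Z y v 0 = Z v y := fun v y => by simp [jet]
  have hj1 : ∀ (v : Var) y, jet k Z y v 1 = deriv (Z v) y := fun v y => by simp [jet]
  match v with
  | Sum.inl 0 =>
    simp only [hamVF, grad, jetPartial_diffeo, lieFields]
    rw [sum_fin_eq_two _ fun n => by simp [hs1]]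
    simp [hj0, coupling]
    rw [hc]; field_simp
  | Sum.inl 1 =>
    simp only [hamVF, grad, jetPartial_diffeo, lieFields]
    rw [sum_fin_eq_two _ fun n => by simp [hs0]]
    simp [hj1, coupling]
    field_simp
  | Sum.inr 0 =>
    simp only [hamVF, grad, jetPartial_diffeo, lieFields]
    rw [sum_fin_eq_two _ fun n => by simp [hs0]]
    simp [hj1, coupling]
    field_simp
  | Sum.inr 1 =>
    simp only [hamVF, grad, jetPartial_diffeo, lieFields]
    rw [sum_fin_eq_two _ fun n => by simp [hs1]]
    simp [hj0, coupling]
    simp only [← mul_assoc (G⁻¹ * 2⁻¹) 2]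
    rw [hc]; field_simp

theorem lieFields_add_smul (hX : IsOpen X) (hM : ContDiffOn ℝ ∞ M X) (hZ : SmoothFields X Z)
    (hB : SmoothFields X B) (s : ℝ) (v : Var) :
    Set.EqOn (lieFields M (Z + s • B) v) ((lieFields M Z + s • lieFields M B) v) X := by
  intro x hx
  have hM' := hasDerivAt_of_smooth hX hM hx
  have hd : ∀ v : Var, deriv (fun y => M y * (Z v y + s * B v y)) x =
      deriv (fun y => M y * Z v y) x + s * deriv (fun y => M y * B v y) x := fun v => by
    have h1 := hasDerivAt_of_smooth hX (hZ v) hx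
    have h2 := hasDerivAt_of_smooth hX (hB v) hx
    rw [(hM'.fun_mul h1).deriv, (hM'.fun_mul h2).deriv,
      (hM'.fun_mul (h1.fun_add (h2.const_mul s))).deriv]
    ring
  have hd' : ∀ v : Var, deriv (Z v + s • B v) x = deriv (Z v) x + s * deriv (B v) x := fun v =>
    ((hasDerivAt_of_smooth hX (hZ v) hx).add
      ((hasDerivAt_of_smooth hX (hB v) hx).const_mul s)).deriv
  match v with
  | Sum.inl 0 => exact hd K1
  | Sum.inl 1 => exact (congrArg (M x * ·) (hd' K2)).trans (by
      simp only [lieFields, Pi.add_apply, Pi.smul_apply, smul_eq_mul]; ring)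
  | Sum.inr 0 => exact (congrArg (M x * ·) (hd' E1)).trans (by
      simp only [lieFields, Pi.add_apply, Pi.smul_apply, smul_eq_mul]; ring)
  | Sum.inr 1 => exact hd E2

end Diffeo

section Covariance

variable {k : ℕ} {X : Set ℝ} {U : Set (Jet k)} {f H μ : Jet k → ℝ} {Z A w : Fields} {M N : ℝ → ℝ}
  {G : ℝ} {x : ℝ}

theorem smooth_muS (hE2 : ∀ j ∈ U, j E2 0 ≠ 0) (hμ : ContDiffOn ℝ ∞ μ U) :
    ContDiffOn ℝ ∞ (muS μ) U := by
  have hc : ∀ (v : Var), ContDiffOn ℝ ∞ (fun j : Jet k => j v 0) U := fun v =>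
    (jetCoord v 0).contDiff.contDiffOn
  exact hμ.mul ((hc E1).div ((hc E2).pow 2) fun j hj => pow_ne_zero 2 (hE2 j hj))

/-! ### Transformation under infinitesimal diffeomorphisms -/

/-- Since `N` is arbitrary, the smeared bracket with `H_x[M]` determines pointwise how the density
`f` changes under the infinitesimal diffeomorphism. -/
theorem fderiv_lieFields_eq_of_bracket (hX : IsOpen X) (hU : IsOpen U) (hG : G ≠ 0)
    (hf : ContDiffOn ℝ ∞ f U) (hZ : Z ∈ phaseSpace X U) (hM : IsTest X M) {R : ℝ → ℝ}
    (hR : ContDiffOn ℝ ∞ R X)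
    (h : ∀ N, IsTest X N → bracket X G (grad f N Z) (grad (diffeo k G) M Z) = ∫ x in X, N x * R x)
    (hx : x ∈ X) : fderiv ℝ f (jet k Z x) (jet k (lieFields M Z) x) = R x := by
  have hA : SmoothFields X (lieFields M Z) := fun v => (isTest_lieFields hX hM hZ.1 v).smooth
  refine eqOn_of_forall_integral_isTest hX
    (f := fun x => fderiv ℝ f (jet k Z x) (jet k (lieFields M Z) x)) ?_ hR (fun N hN => ?_) hx
  · exact ((hf.fderiv_of_isOpen hU (by simp)).comp (smooth_jet hX hZ.1) hZ.2).clm_apply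
      (smooth_jet hX hA)
  · rw [← h N hN, bracket_grad hX hU hf hZ hN
      (smooth_grad hX hU (contDiff_diffeo k G).contDiffOn hZ hM.smooth), hamVF_grad_diffeo k hG]

/-- Integrating `-H[M ∂_x N]` by parts moves the derivative onto `M H`: the second bracket of the
algebra says that `H` is a density of weight one. -/
theorem fderiv_lieFields_of_density (hX : IsOpen X) (hU : IsOpen U) (hG : G ≠ 0)
    (hH : ContDiffOn ℝ ∞ H U) (hAlg : DeformedAlgebra X G U H μ) (hZ : Z ∈ phaseSpace X U)
    (hM : IsTest X M) (hx : x ∈ X) :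
    fderiv ℝ H (jet k Z x) (jet k (lieFields M Z) x) =
      deriv M x * H (jet k Z x) +
        M x * fderiv ℝ H (jet k Z x) (jet k (derivFields Z) x) := by
  have hs := smooth_comp_jet hX hH hZ
  rw [fderiv_lieFields_eq_of_bracket hX hU hG hH hZ hM
    (smooth_deriv hX (hM.smooth.mul hs)) (fun N hN => ?_) hx]
  · exact ((hasDerivAt_of_smooth hX hM.smooth hx).mul (hasDerivAt_comp_jet hX hU hH hZ hx)).deriv
  · rw [((hAlg Z hZ N M hN hM).2.1), integral_mul_deriv_of_isTest hX hN (hM.smooth.mul hs), smear]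
    congr 1
    exact integral_congr_ae (ae_of_all _ fun x => by ring)

/-- The same localisation applied to the first bracket: `H_x` is a density of weight two. -/
theorem fderiv_diffeo_lieFields (hX : IsOpen X) (hU : IsOpen U) (hG : G ≠ 0)
    (hAlg : DeformedAlgebra X G U H μ) (hZ : Z ∈ phaseSpace X U) (hM : IsTest X M) (hx : x ∈ X) :
    fderiv ℝ (diffeo k G) (jet k Z x) (jet k (lieFields M Z) x) =
      2 * deriv M x * diffeo k G (jet k Z x) +
        M x * fderiv ℝ (diffeo k G) (jet k Z x) (jet k (derivFields Z) x) := by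
  have hd : ContDiffOn ℝ ∞ (diffeo k G) U := (contDiff_diffeo k G).contDiffOn
  have hs := smooth_comp_jet hX hd hZ
  rw [fderiv_lieFields_eq_of_bracket hX hU hG hd hZ hM
    (R := fun x => deriv M x * diffeo k G (jet k Z x) +
      deriv (fun x => M x * diffeo k G (jet k Z x)) x)
    (((hM.deriv hX).smooth.mul hs).add (smooth_deriv hX (hM.smooth.mul hs))) (fun N hN => ?_) hx]
  · rw [((hasDerivAt_of_smooth hX hM.smooth hx).fun_mul
      (hasDerivAt_comp_jet hX hU hd hZ hx)).deriv]
    ring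
  · rw [((hAlg Z hZ N M hN hM).1), smear]
    simp only [mul_add]
    rw [integral_add (hN.mul_smooth hX ((hM.deriv hX).smooth.mul hs)).integrableOn
      (hN.mul_smooth hX (smooth_deriv hX (hM.smooth.mul hs))).integrableOn,
      integral_mul_deriv_of_isTest hX hN (hM.smooth.mul hs), ← sub_eq_add_neg,
      ← integral_sub (hN.mul_smooth hX ((hM.deriv hX).smooth.mul hs)).integrableOn
      ((hN.deriv hX).mul_smooth hX (hM.smooth.mul hs)).integrableOn]
    exact integral_congr_ae (ae_of_all _ fun x => by ring)

/-! ### Linearisation along a direction -/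

theorem hasDerivAt_comp_line (hU : IsOpen U) (hf : ContDiffOn ℝ ∞ f U) {j : Jet k} (hj : j ∈ U)
    (b : Jet k) : HasDerivAt (fun s : ℝ => f (j + s • b)) (fderiv ℝ f j b) 0 := by
  have h1 : HasDerivAt (fun s : ℝ => j + s • b) b 0 := by
    simpa using ((hasDerivAt_id (0 : ℝ)).smul_const b).const_add j
  have h2 : HasFDerivAt f (fderiv ℝ f j) (j + (0 : ℝ) • b) := by
    simpa using hasFDerivAt_of_smooth hU hf hj
  exact h2.comp_hasDerivAt 0 h1

theorem hasFDerivAt_fderiv (hU : IsOpen U) (hf : ContDiffOn ℝ ∞ f U) {j : Jet k} (hj : j ∈ U) :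
    HasFDerivAt (fderiv ℝ f) (fderiv ℝ (fderiv ℝ f) j) j :=
  (((hf.contDiffAt_of_isOpen hU hj).fderiv_right (m := ∞) (by simp)).differentiableAt
    (by simp)).hasFDerivAt

theorem hasDerivAt_fderiv_line (hU : IsOpen U) (hf : ContDiffOn ℝ ∞ f U) {j : Jet k} (hj : j ∈ U)
    (b p q : Jet k) : HasDerivAt (fun s : ℝ => fderiv ℝ f (j + s • b) (p + s • q))
      (fderiv ℝ (fderiv ℝ f) j b p + fderiv ℝ f j q) 0 := by
  have h1 : ∀ j b : Jet k, HasDerivAt (fun s : ℝ => j + s • b) b 0 := fun j b => by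
    simpa using ((hasDerivAt_id (0 : ℝ)).smul_const b).const_add j
  have h2 : HasFDerivAt (fderiv ℝ f) (fderiv ℝ (fderiv ℝ f) j) (j + (0 : ℝ) • b) := by
    simpa using hasFDerivAt_fderiv hU hf hj
  have h3 : HasDerivAt (fun s : ℝ => fderiv ℝ f (j + s • b)) (fderiv ℝ (fderiv ℝ f) j b) 0 :=
    h2.comp_hasDerivAt 0 (h1 j b)
  simpa using h3.clm_apply (h1 p q)

theorem fderiv_fderiv_comm (hU : IsOpen U) (hf : ContDiffOn ℝ ∞ f U) {j : Jet k} (hj : j ∈ U)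
    (a b : Jet k) : fderiv ℝ (fderiv ℝ f) j a b = fderiv ℝ (fderiv ℝ f) j b a :=
  (hf.contDiffAt_of_isOpen hU hj).isSymmSndFDerivAt minSmoothness_two_le_infty a b

theorem derivFields_add_smul (hX : IsOpen X) (hZ : SmoothFields X Z) (hw : SmoothFields X w)
    (s : ℝ) (v : Var) :
    Set.EqOn (derivFields (Z + s • w) v) ((derivFields Z + s • derivFields w) v) X := fun _ hx =>
  ((hasDerivAt_of_smooth hX (hZ v) hx).add
    ((hasDerivAt_of_smooth hX (hw v) hx).const_mul s)).deriv

/-- The density law holds on the whole phase space and compactly supported perturbations stay there,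
so it may be differentiated along `Z + s • w`; both sides involve `w` linearly through `lieFields`
and `derivFields`. -/
theorem fderiv_fderiv_lieFields (hX : IsOpen X) (hU : IsOpen U) (hG : G ≠ 0)
    (hH : ContDiffOn ℝ ∞ H U) (hAlg : DeformedAlgebra X G U H μ) (hZ : Z ∈ phaseSpace X U)
    (hM : IsTest X M) (hw : ∀ v, IsTest X (w v)) (hx : x ∈ X) :
    fderiv ℝ (fderiv ℝ H) (jet k Z x) (jet k w x) (jet k (lieFields M Z) x) +
        fderiv ℝ H (jet k Z x) (jet k (lieFields M w) x) =
      deriv M x * fderiv ℝ H (jet k Z x) (jet k w x) +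
        M x * (fderiv ℝ (fderiv ℝ H) (jet k Z x) (jet k w x) (jet k (derivFields Z) x) +
          fderiv ℝ H (jet k Z x) (jet k (derivFields w) x)) := by
  have hwS : SmoothFields X w := fun v => (hw v).smooth
  have hj := hZ.2 x hx
  have hL : ∀ {Z}, SmoothFields X Z → SmoothFields X (lieFields M Z) := fun hZ v =>
    (isTest_lieFields hX hM hZ v).smooth
  have h1 := hasDerivAt_fderiv_line hU hH hj (jet k w x) (jet k (lieFields M Z) x)
    (jet k (lieFields M w) x)
  have h2 := ((hasDerivAt_comp_line hU hH hj (jet k w x)).const_mul (deriv M x)).add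
    ((hasDerivAt_fderiv_line hU hH hj (jet k w x) (jet k (derivFields Z) x)
      (jet k (derivFields w) x)).const_mul (M x))
  refine h1.unique (h2.congr_of_eventuallyEq ?_)
  filter_upwards [eventually_add_smul_mem_phaseSpace hX hU hZ hw] with s hs
  have e := fderiv_lieFields_of_density hX hU hG hH hAlg hs hM hx
  rw [jet_congr hX (lieFields_add_smul hX hM.smooth hZ.1 hwS s) hx,
    jet_congr hX (derivFields_add_smul hX hZ.1 hwS s) hx, jet_add_smul hX hZ.1 hwS s hx,
    jet_add_smul hX (hL hZ.1) (hL hwS) s hx,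
    jet_add_smul hX (SmoothFields.derivFields hX hZ.1) (SmoothFields.derivFields hX hwS) s hx] at e
  exact e

/-- The second variation of `H[N]` in the direction of an infinitesimal diffeomorphism. -/
theorem integral_fderiv_fderiv_lieFields (hX : IsOpen X) (hU : IsOpen U) (hG : G ≠ 0)
    (hH : ContDiffOn ℝ ∞ H U) (hAlg : DeformedAlgebra X G U H μ) (hZ : Z ∈ phaseSpace X U)
    (hM : IsTest X M) (hN : IsTest X N) (hw : ∀ v, IsTest X (w v)) :
    ∫ x in X, N x * fderiv ℝ (fderiv ℝ H) (jet k Z x) (jet k (lieFields M Z) x) (jet k w x) =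
      -(∫ x in X, ∑ v, grad H N Z v x * lieFields M w v x) -
        ∫ x in X, ∑ v, grad H (fun x => M x * deriv N x) Z v x * w v x := by
  have hwS : SmoothFields X w := fun v => (hw v).smooth
  have hLw : SmoothFields X (lieFields M w) := fun v => (isTest_lieFields hX hM hwS v).smooth
  have hdH : ∀ {b : Fields}, SmoothFields X b →
      ContDiffOn ℝ ∞ (fun x => fderiv ℝ H (jet k Z x) (jet k b x)) X := fun hb =>
    ((hH.fderiv_of_isOpen hU (by simp)).comp (smooth_jet hX hZ.1) hZ.2).clm_apply
      (smooth_jet hX hb)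
  have hd : ∀ x ∈ X, deriv (fun x => M x * fderiv ℝ H (jet k Z x) (jet k w x)) x =
      deriv M x * fderiv ℝ H (jet k Z x) (jet k w x) +
        M x * (fderiv ℝ (fderiv ℝ H) (jet k Z x) (jet k (derivFields Z) x) (jet k w x) +
          fderiv ℝ H (jet k Z x) (jet k (derivFields w) x)) := fun x hx => by
    have h1 : HasDerivAt (fun x => fderiv ℝ H (jet k Z x)) _ x :=
      (hasFDerivAt_fderiv hU hH (hZ.2 x hx)).comp_hasDerivAt x (hasDerivAt_jet hX hZ.1 hx)
    exact ((hasDerivAt_of_smooth hX hM.smooth hx).fun_mul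
      (h1.clm_apply (hasDerivAt_jet hX hwS hx))).deriv
  -- By symmetry of the second derivative, the right side of the linearised density law is the total
  -- derivative computed in `hd`; integrating it by parts turns `N` into `M ∂_x N`.
  have hpt : Set.EqOn (fun x => N x *
      fderiv ℝ (fderiv ℝ H) (jet k Z x) (jet k (lieFields M Z) x) (jet k w x))
      (fun x => -(N x * fderiv ℝ H (jet k Z x) (jet k (lieFields M w) x)) +
        N x * deriv (fun x => M x * fderiv ℝ H (jet k Z x) (jet k w x)) x) X := fun x hx => by
    have e := fderiv_fderiv_lieFields hX hU hG hH hAlg hZ hM hw hx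
    rw [fderiv_fderiv_comm hU hH (hZ.2 x hx), fderiv_fderiv_comm hU hH (hZ.2 x hx) _
      (jet k (derivFields Z) x), ← hd x hx] at e
    simp only [← e]; ring
  rw [setIntegral_congr_fun hX.measurableSet hpt,
    integral_add ((hN.mul_smooth hX (hdH hLw)).neg hX).integrableOn
      (hN.mul_smooth hX (smooth_deriv hX (hM.smooth.mul (hdH hwS)))).integrableOn,
    integral_neg, ← integral_grad hX hU hH hZ hN hLw,
    integral_mul_deriv_of_isTest hX hN (hM.smooth.mul (hdH hwS)),
    integral_grad hX hU hH hZ (hM.mul_smooth hX (hN.deriv hX).smooth) hwS, ← sub_eq_add_neg]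
  congr 1
  exact integral_congr_ae (ae_of_all _ fun x => by ring)

theorem integral_mul_deriv_mul_swap (hX : IsOpen X) (hM : IsTest X M) {a b : ℝ → ℝ}
    (ha : IsTest X a) (hb : IsTest X b) :
    ∫ x in X, a x * deriv (fun y => M y * b y) x = -∫ x in X, b x * (M x * deriv a x) := by
  rw [integral_mul_deriv_of_isTest hX ha (hM.smooth.mul hb.smooth)]
  congr 1
  exact integral_congr_ae (ae_of_all _ fun x => by ring)

/-- Infinitesimal diffeomorphisms are symplectic. -/
theorem integral_lieFields_hamVF_symm (hX : IsOpen X) (hM : IsTest X M) {a b : Fields}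
    (ha : ∀ v, IsTest X (a v)) (hb : ∀ v, IsTest X (b v)) :
    ∫ x in X, ∑ v, a v x * lieFields M (hamVF G b) v x =
      ∫ x in X, ∑ v, b v x * lieFields M (hamVF G a) v x := by
  have hL : ∀ {b : Fields}, (∀ v, IsTest X (b v)) → ∀ v, IsTest X (lieFields M (hamVF G b) v) :=
    fun hb v => isTest_lieFields hX hM (fun v => (isTest_hamVF hX hb v).smooth) v
  have hI : ∀ {a b : Fields}, (∀ v, IsTest X (a v)) → (∀ v, IsTest X (b v)) →
      ∫ x in X, ∑ v, a v x * lieFields M (hamVF G b) v x =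
      2 * G * (∫ x in X, a K1 x * deriv (fun y => M y * b E1 y) x) +
      G * (∫ x in X, a K2 x * (M x * deriv (b E2) x)) -
      2 * G * (∫ x in X, a E1 x * (M x * deriv (b K1) x)) -
      G * (∫ x in X, a E2 x * deriv (fun y => M y * b K2 y) x) := fun {a b} ha hb => by
    have hd : ∀ (c : ℝ) (u : ℝ → ℝ) x, deriv (fun y => M y * (c * u y)) x =
        c * deriv (fun y => M y * u y) x := fun c u x => by
      rw [← deriv_const_mul_field]; congr 1; funext y; ring
    rw [integral_finsetSum _ fun v _ => ((ha v).mul_smooth hX (hL hb v).smooth).integrableOn,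
      Fintype.sum_sum_type, Fin.sum_univ_two, Fin.sum_univ_two]
    simp only [lieFields, hamVF, coupling, Matrix.cons_val_zero, Matrix.cons_val_one, hd,
      deriv_const_mul_field, deriv.fun_neg, mul_neg, integral_neg, sub_eq_add_neg,
      ← integral_const_mul]
    have e : ∀ {p q r s p' q' r' s' : ℝ}, p = p' → q = q' → r = r' → s = s' →
        p + q + (-r + -s) = p' + q' + -r' + -s' := by intros; subst_vars; ring
    refine e ?_ ?_ ?_ ?_ <;> exact integral_congr_ae (ae_of_all _ fun x => by ring)
  rw [hI ha hb, hI hb ha, integral_mul_deriv_mul_swap hX hM (ha _) (hb _),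
    integral_mul_deriv_mul_swap hX hM (ha _) (hb _), integral_mul_deriv_mul_swap hX hM (hb _) (ha _),
    integral_mul_deriv_mul_swap hX hM (hb _) (ha _)]
  ring

end Covariance

section Jacobi

variable {k : ℕ} {X : Set ℝ} {U : Set (Jet k)} {f H μ : Jet k → ℝ} {Z A w : Fields}
  {M N N₁ N₂ : ℝ → ℝ} {G : ℝ} {x : ℝ}

/-! ### The Jacobi identity for two Hamiltonian constraints and a diffeomorphism -/

/-- The derivative of `grad f N` at `Z` in the direction `A`. -/
def gradVar (f : Jet k → ℝ) (N : ℝ → ℝ) (Z A : Fields) : Fields :=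
  adjointOp (fun v n x =>
    fderiv ℝ (fderiv ℝ f) (jet k Z x) (jet k A x) (Pi.single v (Pi.single n 1))) N

theorem smooth_fderiv_fderiv_comp (hX : IsOpen X) (hU : IsOpen U) (hf : ContDiffOn ℝ ∞ f U)
    (hZ : Z ∈ phaseSpace X U) (hA : SmoothFields X A) (w : Jet k) :
    ContDiffOn ℝ ∞ (fun x => fderiv ℝ (fderiv ℝ f) (jet k Z x) (jet k A x) w) X :=
  (((((hf.fderiv_of_isOpen hU (m := ∞) (by simp)).fderiv_of_isOpen hU (m := ∞) (by simp)).comp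
    (smooth_jet hX hZ.1) hZ.2).clm_apply (smooth_jet hX hA))).clm_apply contDiffOn_const

theorem integral_gradVar (hX : IsOpen X) (hU : IsOpen U) (hf : ContDiffOn ℝ ∞ f U)
    (hZ : Z ∈ phaseSpace X U) (hA : SmoothFields X A) (hN : IsTest X N) (hw : SmoothFields X w) :
    ∫ x in X, ∑ v, gradVar f N Z A v x * w v x =
      ∫ x in X, N x * fderiv ℝ (fderiv ℝ f) (jet k Z x) (jet k A x) (jet k w x) := by
  simp only [continuousLinearMap_apply_jet (fderiv ℝ (fderiv ℝ f) _ _) (jet k w _)]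
  exact integral_adjointOp hX (fun v n => smooth_fderiv_fderiv_comp hX hU hf hZ hA _) hN hw

theorem smooth_line {O : Set (ℝ × ℝ)} (hO : ∀ p ∈ O, p.2 ∈ X) (hZ : SmoothFields X Z)
    (hA : SmoothFields X A) (v : Var) :
    ContDiffOn ℝ ∞ (fun p : ℝ × ℝ => (Z + p.1 • A) v p.2) O :=
  ((hZ v).comp contDiff_snd.contDiffOn hO).add
    (contDiff_fst.contDiffOn.mul ((hA v).comp contDiff_snd.contDiffOn hO))

theorem smooth_comp_jet_line (hX : IsOpen X) (hf : ContDiffOn ℝ ∞ f U) (hZ : SmoothFields X Z)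
    (hA : SmoothFields X A) {S : Set ℝ} (hSo : IsOpen S)
    (hS : ∀ s ∈ S, Z + s • A ∈ phaseSpace X U) :
    ContDiffOn ℝ ∞ (fun p : ℝ × ℝ => f (jet k (Z + p.1 • A) p.2)) (S ×ˢ X) :=
  hf.comp (smooth_jet_history (Z := fun s => Z + s • A) (hSo.prod hX)
    (smooth_line (fun _ hp => hp.2) hZ hA)) fun p hp => (hS p.1 hp.1).2 p.2 hp.2

theorem smooth_mul_jetPartial_line (hX : IsOpen X) (hU : IsOpen U) (hf : ContDiffOn ℝ ∞ f U)
    (hZ : SmoothFields X Z) (hA : SmoothFields X A) {S : Set ℝ} (hSo : IsOpen S)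
    (hS : ∀ s ∈ S, Z + s • A ∈ phaseSpace X U) (hN : ContDiffOn ℝ ∞ N X) (v : Var)
    (n : Fin (k + 2)) :
    ContDiffOn ℝ ∞ (fun p : ℝ × ℝ => N p.2 * jetPartial f v n (jet k (Z + p.1 • A) p.2))
      (S ×ˢ X) :=
  (hN.comp contDiff_snd.contDiffOn fun _ hp => hp.2).mul
    (smooth_comp_jet_line hX (smooth_jetPartial hU hf v n) hZ hA hSo hS)

theorem smooth_grad_line (hX : IsOpen X) (hU : IsOpen U) (hf : ContDiffOn ℝ ∞ f U)
    (hZ : SmoothFields X Z) (hA : SmoothFields X A) {S : Set ℝ} (hSo : IsOpen S)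
    (hS : ∀ s ∈ S, Z + s • A ∈ phaseSpace X U) (hN : ContDiffOn ℝ ∞ N X) (v : Var) :
    ContDiffOn ℝ ∞ (fun p : ℝ × ℝ => grad f N (Z + p.1 • A) v p.2) (S ×ˢ X) :=
  ContDiffOn.sum fun n _ => contDiffOn_const.mul
    (smooth_iteratedDeriv_snd (F := fun s y => N y * jetPartial f v n (jet k (Z + s • A) y))
      (hSo.prod hX) (smooth_mul_jetPartial_line hX hU hf hZ hA hSo hS hN v n) n)

theorem hasDerivAt_comp_jet_line (hX : IsOpen X) (hU : IsOpen U) (hf : ContDiffOn ℝ ∞ f U)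
    (hZ : Z ∈ phaseSpace X U) (hA : SmoothFields X A) (hx : x ∈ X) :
    HasDerivAt (fun s : ℝ => f (jet k (Z + s • A) x)) (fderiv ℝ f (jet k Z x) (jet k A x)) 0 := by
  simpa only [jet_add_smul hX hZ.1 hA _ hx] using hasDerivAt_comp_line hU hf (hZ.2 x hx) (jet k A x)

/-- The parameter derivative passes through each `∂_x^n` and then falls on the coefficient
`jetPartial`, producing the second derivative of `f`. -/
theorem hasDerivAt_grad_line (hX : IsOpen X) (hU : IsOpen U) (hf : ContDiffOn ℝ ∞ f U)
    (hZ : Z ∈ phaseSpace X U) (hA : SmoothFields X A) {S : Set ℝ} (hSo : IsOpen S) (h0 : 0 ∈ S)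
    (hS : ∀ s ∈ S, Z + s • A ∈ phaseSpace X U) (hN : ContDiffOn ℝ ∞ N X) (v : Var) (hx : x ∈ X) :
    HasDerivAt (fun s : ℝ => grad f N (Z + s • A) v x) (gradVar f N Z A v x) 0 := by
  refine HasDerivAt.fun_sum fun n _ => ?_
  have h := hasDerivAt_iteratedDeriv_param (hSo.prod hX) (n : ℕ)
    (F := fun s y => N y * jetPartial f v n (jet k (Z + s • A) y))
    (smooth_mul_jetPartial_line hX hU hf hZ.1 hA hSo hS hN v n) (s := 0) (x := x) ⟨h0, hx⟩
  have e : Set.EqOn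
      (fun y => deriv (fun s : ℝ => N y * jetPartial f v n (jet k (Z + s • A) y)) 0)
      (fun y => N y *
        fderiv ℝ (fderiv ℝ f) (jet k Z y) (jet k A y) (Pi.single v (Pi.single n 1))) X := by
    intro y hy
    have h1 := hasDerivAt_comp_jet_line hX hU (smooth_jetPartial hU hf v n) hZ hA hy
    have h2 := ((hasFDerivAt_fderiv hU hf (hZ.2 y hy)).clm_apply
      (hasFDerivAt_const (Pi.single v (Pi.single n 1) : Jet k) (jet k Z y))).fderiv
    have h3 : fderiv ℝ (jetPartial f v n) (jet k Z y) = _ := h2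
    rw [h3] at h1
    refine (h1.const_mul (N y)).deriv.trans ?_
    simp
  rw [iteratedDeriv_congr_on hX e n hx] at h
  exact h.const_mul _

theorem hasDerivAt_hamVF {a : ℝ → Fields} {a' : Fields} {s : ℝ}
    (h : ∀ v, HasDerivAt (fun s => a s v x) (a' v x) s) (v : Var) :
    HasDerivAt (fun s => hamVF G (a s) v x) (hamVF G a' v x) s := by
  cases v with
  | inl I => exact (h _).const_mul _
  | inr I => exact ((h _).const_mul _).neg

theorem exists_ball_phaseSpace (hX : IsOpen X) (hU : IsOpen U)
    (hZ : Z ∈ phaseSpace X U) (hA : ∀ v, IsTest X (A v)) :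
    ∃ ε > 0, ∀ s ∈ Metric.ball (0 : ℝ) ε, Z + s • A ∈ phaseSpace X U := by
  obtain ⟨ε, hε, h⟩ := Metric.eventually_nhds_iff_ball.1
    (eventually_add_smul_mem_phaseSpace hX hU hZ hA)
  exact ⟨ε, hε, h⟩

/-- Product rule under the integral sign; antisymmetry brings the varied gradient of the second term
into the first slot, whence the minus sign. -/
theorem hasDerivAt_bracket_line (hX : IsOpen X) (hU : IsOpen U) (hH : ContDiffOn ℝ ∞ H U)
    (hZ : Z ∈ phaseSpace X U) (hA : ∀ v, IsTest X (A v)) (hN₁ : IsTest X N₁) (hN₂ : IsTest X N₂) :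
    HasDerivAt (fun s : ℝ => bracket X G (grad H N₁ (Z + s • A)) (grad H N₂ (Z + s • A)))
      (bracket X G (gradVar H N₁ Z A) (grad H N₂ Z) -
        bracket X G (gradVar H N₂ Z A) (grad H N₁ Z)) 0 := by
  have hAS : SmoothFields X A := fun v => (hA v).smooth
  obtain ⟨ε, hε, hS⟩ := exists_ball_phaseSpace hX hU hZ hA
  have h0 : (0 : ℝ) ∈ Metric.ball (0 : ℝ) ε := Metric.mem_ball_self hε
  have hsm : ∀ {N}, IsTest X N → ∀ v, ContDiffOn ℝ ∞
      (fun p : ℝ × ℝ => grad H N (Z + p.1 • A) v p.2) (Metric.ball 0 ε ×ˢ X) := fun hN v =>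
    smooth_grad_line hX hU hH hZ.1 hAS Metric.isOpen_ball hS hN.smooth v
  have hd : ∀ {N}, IsTest X N → ∀ x ∈ X, ∀ v, HasDerivAt
      (fun s : ℝ => grad H N (Z + s • A) v x) (gradVar H N Z A v x) 0 := fun hN x hx v =>
    hasDerivAt_grad_line hX hU hH hZ hAS Metric.isOpen_ball h0 hS hN.smooth v hx
  have hg : ∀ {N}, IsTest X N → ∀ v, IsTest X (gradVar H N Z A v) := fun hN v =>
    isTest_adjointOp hX (fun v n => smooth_fderiv_fderiv_comp hX hU hH hZ hAS _) hN v
  have hb : ∀ {N}, IsTest X N → ∀ v, IsTest X (grad H N Z v) := fun hN v =>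
    isTest_grad hX hU hH hZ hN v
  -- The support of `N₁` is a compact set valid for every `s`, because `grad H N₁` vanishes off it
  -- at any configuration.
  have key := hasDerivAt_integral_param hε hX hN₁.2.1 hN₁.2.2
    (F := fun s x => ∑ v, grad H N₁ (Z + s • A) v x * hamVF G (grad H N₂ (Z + s • A)) v x)
    (ContDiffOn.sum fun v _ => (hsm hN₁ v).mul (by
      cases v with
      | inl I => exact contDiffOn_const.mul (hsm hN₂ _)
      | inr I => exact (contDiffOn_const.mul (hsm hN₂ _)).neg))
    (fun s x hx => Finset.sum_eq_zero fun v _ => by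
      rw [grad_eq_zero (notMem_tsupport_iff_eventuallyEq.1 hx), zero_mul])
  simp only [bracket_eq (grad H N₁ (Z + _ • A))]
  refine key.congr_deriv ?_
  rw [sub_eq_add_neg, ← bracket_swap, bracket_eq, bracket_eq, ← integral_add
    (IsTest.sum hX _ fun v _ => (hg hN₁ v).mul_smooth hX
      (isTest_hamVF hX (hb hN₂) v).smooth).integrableOn
    (IsTest.sum hX _ fun v _ => (hb hN₁ v).mul_smooth hX
      (isTest_hamVF hX (hg hN₂) v).smooth).integrableOn]
  refine setIntegral_congr_fun hX.measurableSet fun x hx => ?_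
  have h1 := HasDerivAt.fun_sum (u := Finset.univ) fun v _ =>
    (hd hN₁ x hx v).fun_mul (hasDerivAt_hamVF (G := G) (hd hN₂ x hx) v)
  simp only [zero_smul, add_zero] at h1
  simpa only [← Finset.sum_add_distrib] using h1.deriv

/-- The derivative of `{H[N₁], H[N₂]}` along an infinitesimal diffeomorphism. -/
theorem hasDerivAt_bracket_lieFields (hX : IsOpen X) (hU : IsOpen U) (hG : G ≠ 0)
    (hH : ContDiffOn ℝ ∞ H U) (hAlg : DeformedAlgebra X G U H μ) (hZ : Z ∈ phaseSpace X U)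
    (hM : IsTest X M) (hN₁ : IsTest X N₁) (hN₂ : IsTest X N₂) :
    HasDerivAt (fun s : ℝ => bracket X G (grad H N₁ (Z + s • lieFields M Z))
        (grad H N₂ (Z + s • lieFields M Z)))
      (bracket X G (grad H (fun x => M x * deriv N₂ x) Z) (grad H N₁ Z) -
        bracket X G (grad H (fun x => M x * deriv N₁ x) Z) (grad H N₂ Z)) 0 := by
  have hA := isTest_lieFields hX hM hZ.1
  have hAS : SmoothFields X (lieFields M Z) := fun v => (hA v).smooth
  have hb : ∀ {N}, IsTest X N → ∀ v, IsTest X (grad H N Z v) := fun hN v =>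
    isTest_grad hX hU hH hZ hN v
  have e : ∀ {N N'}, IsTest X N → IsTest X N' →
      bracket X G (gradVar H N Z (lieFields M Z)) (grad H N' Z) =
        -(∫ x in X, ∑ v, grad H N Z v x * lieFields M (hamVF G (grad H N' Z)) v x) -
          bracket X G (grad H (fun x => M x * deriv N x) Z) (grad H N' Z) := fun hN hN' => by
    rw [bracket_eq, integral_gradVar hX hU hH hZ hAS hN
      (fun v => (isTest_hamVF hX (hb hN') v).smooth), integral_fderiv_fderiv_lieFields hX hU hG hH
      hAlg hZ hM hN (isTest_hamVF hX (hb hN')), bracket_eq]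
  refine (hasDerivAt_bracket_line hX hU hH hZ hA hN₁ hN₂).congr_deriv ?_
  -- The two terms containing `lieFields` are equal because the diffeomorphism is symplectic, and
  -- they enter with opposite signs. This cancellation is the content of the Jacobi identity here.
  rw [e hN₁ hN₂, e hN₂ hN₁, integral_lieFields_hamVF_symm hX hM (hb hN₁) (hb hN₂)]
  ring

/-- The derivative of `{H[N₁], H[N₂]}` along the diffeomorphism is computed twice: by the Jacobi
identity, and by differentiating the right side of the algebra, where the weight two of `H_x` is
used. What fails to cancel is `H_x` times the defect of `μS`, weighted by the Wronskian of `N₁` and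
`N₂`. -/
theorem diffeo_mul_defect_integral (hX : IsOpen X) (hU : IsOpen U) (hG : G ≠ 0)
    (hE2 : ∀ j ∈ U, j E2 0 ≠ 0)
    (hH : ContDiffOn ℝ ∞ H U) (hμ : ContDiffOn ℝ ∞ μ U) (hAlg : DeformedAlgebra X G U H μ)
    (hZ : Z ∈ phaseSpace X U) (hM : IsTest X M) (hN₁ : IsTest X N₁) (hN₂ : IsTest X N₂) :
    ∫ x in X, (N₁ x * deriv N₂ x - N₂ x * deriv N₁ x) * (diffeo k G (jet k Z x) *
      (fderiv ℝ (muS μ) (jet k Z x) (jet k (lieFields M Z) x) + 2 * deriv M x * muS μ (jet k Z x) -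
        M x * fderiv ℝ (muS μ) (jet k Z x) (jet k (derivFields Z) x))) = 0 := by
  have hA := isTest_lieFields hX hM hZ.1
  have hAS : SmoothFields X (lieFields M Z) := fun v => (hA v).smooth
  have hd : ContDiffOn ℝ ∞ (diffeo k G) U := (contDiff_diffeo k G).contDiffOn
  have hm := smooth_muS hE2 hμ
  obtain ⟨ε, hε, hS⟩ := exists_ball_phaseSpace hX hU hZ hA
  set W : ℝ → ℝ := fun x => N₁ x * deriv N₂ x - N₂ x * deriv N₁ x with hWdef
  have hW : IsTest X W := (hN₁.mul_smooth hX (hN₂.deriv hX).smooth).sub hX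
    (hN₂.mul_smooth hX (hN₁.deriv hX).smooth)
  have h1 := hasDerivAt_bracket_lieFields hX hU hG hH hAlg hZ hM hN₁ hN₂
  have h2 := hasDerivAt_integral_param hε hX hW.2.1 hW.2.2
    (F := fun s x => diffeo k G (jet k (Z + s • lieFields M Z) x) *
      (muS μ (jet k (Z + s • lieFields M Z) x) * W x))
    ((smooth_comp_jet_line hX hd hZ.1 hAS Metric.isOpen_ball hS).mul
      ((smooth_comp_jet_line hX hm hZ.1 hAS Metric.isOpen_ball hS).mul
        (hW.smooth.comp contDiff_snd.contDiffOn fun _ hp => hp.2)))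
    (fun s x hx => by simp [image_eq_zero_of_notMem_tsupport hx])
  have h3 := h1.unique (h2.congr_of_eventuallyEq (by
    filter_upwards [Metric.ball_mem_nhds (0 : ℝ) hε] with s hs
    exact (hAlg _ (hS s hs) N₁ N₂ hN₁ hN₂).2.2))
  have hMd : ∀ {N}, IsTest X N → IsTest X fun x => M x * deriv N x := fun hN =>
    hM.mul_smooth hX (hN.deriv hX).smooth
  rw [(hAlg Z hZ _ _ (hMd hN₂) hN₁).2.2, (hAlg Z hZ _ _ (hMd hN₁) hN₂).2.2, smear, smear] at h3
  have hdiff : ∀ {N}, IsTest X N → ∀ x ∈ X, HasDerivAt N (deriv N x) x := fun hN x hx =>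
    hasDerivAt_of_smooth hX hN.smooth hx
  have hds := smooth_comp_jet hX hd hZ
  have hms := smooth_comp_jet hX hm hZ
  have hB : ∀ {N N'}, IsTest X N → IsTest X N' → IsTest X fun x => diffeo k G (jet k Z x) *
      (muS μ (jet k Z x) * (M x * deriv N x * deriv N' x -
        N' x * deriv (fun x => M x * deriv N x) x)) := fun hN hN' =>
    IsTest.smooth_mul hX (IsTest.smooth_mul hX (((hMd hN).mul_smooth hX (hN'.deriv hX).smooth).sub
      hX (hN'.mul_smooth hX ((hMd hN).deriv hX).smooth)) hms) hds
  have hdd : ∀ {N}, IsTest X N → ∀ x ∈ X, deriv (fun x => M x * deriv N x) x =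
      deriv M x * deriv N x + M x * deriv (deriv N) x := fun hN x hx =>
    ((hdiff hM x hx).fun_mul (hdiff (hN.deriv hX) x hx)).deriv
  have hMW : IsTest X fun x => M x * W x := hM.mul_smooth hX hW.smooth
  have hMWd : ∀ x ∈ X, deriv (fun x => M x * W x) x = deriv M x * W x +
      M x * (N₁ x * deriv (deriv N₂) x - N₂ x * deriv (deriv N₁) x) := fun x hx => by
    rw [((hdiff hM x hx).fun_mul (((hdiff hN₁ x hx).fun_mul (hdiff (hN₂.deriv hX) x hx)).fun_sub
      ((hdiff hN₂ x hx).fun_mul (hdiff (hN₁.deriv hX) x hx)))).deriv]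
    simp only [hWdef]; ring
  have hF : ∀ x ∈ X, HasDerivAt (fun x => diffeo k G (jet k Z x) * muS μ (jet k Z x)) _ x :=
    fun x hx => (hasDerivAt_comp_jet hX hU hd hZ hx).mul (hasDerivAt_comp_jet hX hU hm hZ hx)
  have h4 := integral_mul_deriv_of_isTest hX hMW (hds.mul hms)
  rw [← integral_sub (hB hN₂ hN₁).integrableOn (hB hN₁ hN₂).integrableOn] at h3
  -- The Wronskians of `(M N₂', N₁)` and `(M N₁', N₂)` differ by minus the derivative of `M W`; no
  -- second derivatives are left after integrating by parts.
  have h5 : ∀ x ∈ X, diffeo k G (jet k Z x) * (muS μ (jet k Z x) * (M x * deriv N₂ x * deriv N₁ x -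
        N₁ x * deriv (fun x => M x * deriv N₂ x) x)) -
      diffeo k G (jet k Z x) * (muS μ (jet k Z x) * (M x * deriv N₁ x * deriv N₂ x -
        N₂ x * deriv (fun x => M x * deriv N₁ x) x)) =
      -(deriv (fun x => M x * W x) x * (diffeo k G (jet k Z x) * muS μ (jet k Z x))) :=
    fun x hx => by
      rw [hMWd x hx, hdd hN₁ x hx, hdd hN₂ x hx]
      simp only [hWdef]; ring
  rw [setIntegral_congr_fun hX.measurableSet h5, integral_neg, ← h4] at h3
  have h6 : ∀ x ∈ X, deriv (fun s : ℝ => diffeo k G (jet k (Z + s • lieFields M Z) x) *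
      (muS μ (jet k (Z + s • lieFields M Z) x) * W x)) 0 -
      M x * W x * deriv (fun x => diffeo k G (jet k Z x) * muS μ (jet k Z x)) x =
      W x * (diffeo k G (jet k Z x) *
      (fderiv ℝ (muS μ) (jet k Z x) (jet k (lieFields M Z) x) + 2 * deriv M x * muS μ (jet k Z x) -
        M x * fderiv ℝ (muS μ) (jet k Z x) (jet k (derivFields Z) x))) := fun x hx => by
    rw [(hF x hx).deriv, ((hasDerivAt_comp_jet_line hX hU hd hZ hAS hx).fun_mul
      ((hasDerivAt_comp_jet_line hX hU hm hZ hAS hx).mul_const (W x))).deriv,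
      fderiv_diffeo_lieFields hX hU hG hAlg hZ hM hx]
    simp only [zero_smul, add_zero]
    ring
  rw [← setIntegral_congr_fun hX.measurableSet h6, integral_sub, h3, sub_self]
  · refine IntegrableOn.congr_fun (f := fun x => W x * (fderiv ℝ (diffeo k G) (jet k Z x)
      (jet k (lieFields M Z) x) * muS μ (jet k Z x) + diffeo k G (jet k Z x) *
      fderiv ℝ (muS μ) (jet k Z x) (jet k (lieFields M Z) x))) ?_ (fun x hx => ?_) hX.measurableSet
    · refine (hW.mul_smooth hX ?_).integrableOn
      have hdf : ∀ {f : Jet k → ℝ}, ContDiffOn ℝ ∞ f U → ContDiffOn ℝ ∞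
          (fun x => fderiv ℝ f (jet k Z x) (jet k (lieFields M Z) x)) X := fun hf =>
        ((hf.fderiv_of_isOpen hU (by simp)).comp (smooth_jet hX hZ.1) hZ.2).clm_apply
          (smooth_jet hX hAS)
      exact ((hdf hd).mul hms).add (hds.mul (hdf hm))
    · rw [((hasDerivAt_comp_jet_line hX hU hd hZ hAS hx).fun_mul
        ((hasDerivAt_comp_jet_line hX hU hm hZ hAS hx).mul_const (W x))).deriv]
      simp only [zero_smul, add_zero]
      ring
  · exact (hMW.mul_smooth hX (smooth_deriv hX (hds.mul hms))).integrableOn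

/-- Wronskians of smearing functions span enough to localise: suitable sums of two of them produce
an arbitrary smearing function near the given point. -/
theorem diffeo_mul_defect (hX : IsOpen X) (hU : IsOpen U) (hG : G ≠ 0)
    (hE2 : ∀ j ∈ U, j E2 0 ≠ 0)
    (hH : ContDiffOn ℝ ∞ H U) (hμ : ContDiffOn ℝ ∞ μ U) (hAlg : DeformedAlgebra X G U H μ)
    (hZ : Z ∈ phaseSpace X U) (hM : IsTest X M) (hx : x ∈ X) :
    diffeo k G (jet k Z x) *
      (fderiv ℝ (muS μ) (jet k Z x) (jet k (lieFields M Z) x) + 2 * deriv M x * muS μ (jet k Z x) -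
        M x * fderiv ℝ (muS μ) (jet k Z x) (jet k (derivFields Z) x)) = 0 := by
  have hm := smooth_muS hE2 hμ
  have hdf : ∀ {w : Fields}, SmoothFields X w → ContDiffOn ℝ ∞
      (fun x => fderiv ℝ (muS μ) (jet k Z x) (jet k w x)) X := fun hw =>
    ((hm.fderiv_of_isOpen hU (by simp)).comp (smooth_jet hX hZ.1) hZ.2).clm_apply
      (smooth_jet hX hw)
  set D : ℝ → ℝ := fun x => diffeo k G (jet k Z x) *
      (fderiv ℝ (muS μ) (jet k Z x) (jet k (lieFields M Z) x) + 2 * deriv M x * muS μ (jet k Z x) -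
        M x * fderiv ℝ (muS μ) (jet k Z x) (jet k (derivFields Z) x)) with hD
  have hDs : ContDiffOn ℝ ∞ D X := (smooth_comp_jet hX (contDiff_diffeo k G).contDiffOn hZ).mul
    (((hdf fun v => (isTest_lieFields hX hM hZ.1 v).smooth).add
      ((contDiffOn_const.mul (hM.deriv hX).smooth).mul (smooth_comp_jet hX hm hZ))).sub
      (hM.smooth.mul (hdf (SmoothFields.derivFields hX hZ.1))))
  obtain ⟨φ, hφ, hφ1⟩ := exists_isTest_eventuallyEq_one hX isCompact_singleton
    (Set.singleton_subset_iff.2 hx)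
  have hid : ContDiffOn ℝ ∞ (fun x : ℝ => x) X := contDiff_id.contDiffOn
  -- the antisymmetrised products of `φ` with `x ψ` and of `ψ` with `x φ` add up to `2 φ ψ`
  have h := eq_zero_of_forall_integral_isTest hX (hφ.smooth.mul hDs) (fun ψ hψ => by
    have e1 := diffeo_mul_defect_integral hX hU hG hE2 hH hμ hAlg hZ hM hφ (hψ.smooth_mul hX hid)
    have e2 := diffeo_mul_defect_integral hX hU hG hE2 hH hμ hAlg hZ hM hψ (hφ.smooth_mul hX hid)
    have hW : ∀ {N N'}, IsTest X N → IsTest X N' →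
        IsTest X fun x => (N x * deriv N' x - N' x * deriv N x) * D x := fun h h' =>
      ((h.mul_smooth hX (h'.deriv hX).smooth).sub hX
        (h'.mul_smooth hX (h.deriv hX).smooth)).mul_smooth hX hDs
    have e3 := integral_add (hW hφ (hψ.smooth_mul hX hid)).integrableOn
      (hW hψ (hφ.smooth_mul hX hid)).integrableOn
    rw [show (∫ x in X, (φ x * deriv (fun x => x * ψ x) x - x * ψ x * deriv φ x) * D x) = 0 from e1,
      show (∫ x in X, (ψ x * deriv (fun x => x * φ x) x - x * φ x * deriv ψ x) * D x) = 0 from e2,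
      add_zero] at e3
    have e4 : ∀ x ∈ X, (φ x * deriv (fun x => x * ψ x) x - x * ψ x * deriv φ x) * D x +
        (ψ x * deriv (fun x => x * φ x) x - x * φ x * deriv ψ x) * D x =
        2 * (ψ x * (φ x * D x)) := fun x hx => by
      rw [((hasDerivAt_id' x).fun_mul (hasDerivAt_of_smooth hX hψ.smooth hx)).deriv,
        ((hasDerivAt_id' x).fun_mul (hasDerivAt_of_smooth hX hφ.smooth hx)).deriv]
      ring
    rw [setIntegral_congr_fun hX.measurableSet e4, integral_const_mul] at e3
    linarith) x hx
  have hφx : φ x = 1 := (hφ1 x rfl).self_of_nhds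
  simp only [hφx, one_mul] at h
  exact h

/-- The structure function transforms under infinitesimal diffeomorphisms like an inverse metric
component. -/
theorem fderiv_muS_lieFields (hX : IsOpen X) (hU : IsOpen U) (hG : G ≠ 0)
    (hE2 : ∀ j ∈ U, j E2 0 ≠ 0)
    (hH : ContDiffOn ℝ ∞ H U) (hμ : ContDiffOn ℝ ∞ μ U) (hAlg : DeformedAlgebra X G U H μ)
    (hZ : Z ∈ phaseSpace X U) (hM : IsTest X M) (hx : x ∈ X) :
    fderiv ℝ (muS μ) (jet k Z x) (jet k (lieFields M Z) x) =
      M x * fderiv ℝ (muS μ) (jet k Z x) (jet k (derivFields Z) x) -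
        2 * deriv M x * muS μ (jet k Z x) := by
  have hm := smooth_muS hE2 hμ
  have hj := hZ.2 x hx
  obtain ⟨φ, hφ, hφ1⟩ := exists_isTest_eventuallyEq_one hX isCompact_singleton
    (Set.singleton_subset_iff.2 hx)
  -- Of the jet entries occurring in `H_x`, this changes at `x` only `∂_x K₂`, by one unit. Hence
  -- `H_x` is affine in `s` there with slope `E²/G`, which is nonzero.
  set w : Fields := fun v y => if v = K2 then φ y * (y - x) else 0 with hw
  have hwT : ∀ v, IsTest X (w v) := fun v => by
    by_cases h : v = K2
    · simpa only [hw, h, if_true] using hφ.mul_smooth hX (f := fun y => y - x) (by fun_prop)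
    · simpa only [hw, h, if_false] using IsTest.zero
  have hwS : SmoothFields X w := fun v => (hwT v).smooth
  have hL : ∀ {Z}, SmoothFields X Z → SmoothFields X (lieFields M Z) := fun hZ v =>
    (isTest_lieFields hX hM hZ v).smooth
  have hw0 : ∀ v, jet k w x v 0 = 0 := fun v => by
    by_cases h : v = K2 <;> simp [jet, hw, h]
  have hw1 : ∀ v, jet k w x v 1 = if v = K2 then 1 else 0 := fun v => by
    have hφx : φ x = 1 := (hφ1 x rfl).self_of_nhds
    by_cases h : v = K2
    · have := (hasDerivAt_of_smooth hX hφ.smooth hx).fun_mul ((hasDerivAt_id' x).sub_const x)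
      simpa [jet, hw, h, hφx] using this.deriv
    · simp [jet, hw, h]
  have hdiff : ∀ s : ℝ, diffeo k G (jet k (Z + s • w) x) =
      diffeo k G (jet k Z x) + s * (jet k Z x E2 0 / G) := fun s => by
    rw [jet_add_smul hX hZ.1 hwS s hx]
    simp [diffeo, hw0, hw1]
    field_simp
    ring
  set D : ℝ → ℝ := fun s => fderiv ℝ (muS μ) (jet k (Z + s • w) x)
      (jet k (lieFields M (Z + s • w)) x) + 2 * deriv M x * muS μ (jet k (Z + s • w) x) -
        M x * fderiv ℝ (muS μ) (jet k (Z + s • w) x) (jet k (derivFields (Z + s • w)) x) with hD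
  have hDc : ContinuousAt D 0 := by
    have hD' : D = fun s => fderiv ℝ (muS μ) (jet k Z x + s • jet k w x)
      (jet k (lieFields M Z) x + s • jet k (lieFields M w) x) +
        2 * deriv M x * muS μ (jet k Z x + s • jet k w x) -
        M x * fderiv ℝ (muS μ) (jet k Z x + s • jet k w x)
          (jet k (derivFields Z) x + s • jet k (derivFields w) x) := by
      funext s
      simp only [hD]
      rw [jet_congr hX (lieFields_add_smul hX hM.smooth hZ.1 hwS s) hx,
        jet_congr hX (derivFields_add_smul hX hZ.1 hwS s) hx, jet_add_smul hX hZ.1 hwS s hx,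
        jet_add_smul hX (hL hZ.1) (hL hwS) s hx,
        jet_add_smul hX (SmoothFields.derivFields hX hZ.1) (SmoothFields.derivFields hX hwS) s hx]
    rw [hD']
    exact (((hasDerivAt_fderiv_line hU hm hj _ _ _).add
      ((hasDerivAt_comp_line hU hm hj _).const_mul _)).sub
        ((hasDerivAt_fderiv_line hU hm hj _ _ _).const_mul _)).continuousAt
  have hE : jet k Z x E2 0 / G ≠ 0 := div_ne_zero (hE2 _ hj) hG
  -- For small nonzero `s` the perturbed `H_x` does not vanish at `x`, so the defect itself must.
  have hev : ∀ᶠ s in 𝓝[≠] (0 : ℝ), D s = 0 := by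
    have h1 : ∀ᶠ s in 𝓝[≠] (0 : ℝ), diffeo k G (jet k (Z + s • w) x) ≠ 0 := by
      by_cases h0 : diffeo k G (jet k Z x) = 0
      · filter_upwards [self_mem_nhdsWithin] with s hs
        rw [hdiff, h0, zero_add]
        exact mul_ne_zero hs hE
      · have hc : ContinuousAt (fun s : ℝ => diffeo k G (jet k (Z + s • w) x)) 0 := by
          simp only [hdiff]; fun_prop
        exact (hc.eventually_ne (by simpa using h0)).filter_mono nhdsWithin_le_nhds
    filter_upwards [h1, (eventually_add_smul_mem_phaseSpace hX hU hZ hwT).filter_mono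
      nhdsWithin_le_nhds] with s hs hsP
    exact (mul_eq_zero.1 (diffeo_mul_defect hX hU hG hE2 hH hμ hAlg hsP hM hx)).resolve_left hs
  have hlim : D 0 = 0 := tendsto_nhds_unique
    ((hDc.tendsto.mono_left nhdsWithin_le_nhds).congr' hev) tendsto_const_nhds
  simp only [hD, zero_smul, add_zero] at hlim
  linarith

end Jacobi

section Metric

variable {k : ℕ} {X : Set ℝ} {U : Set (Jet k)} {H μ : Jet k → ℝ} {Z A : Fields} {G x : ℝ}

/-! ### The effective metric and its Lie derivative -/

/-- The radial component `g_{xx} = 1 / (μ S)` of the effective metric. -/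
def radial (μ : Jet k → ℝ) (Z : Fields) (x : ℝ) : ℝ := (muS μ (jet k Z x))⁻¹

theorem metric_eq (μ : Jet k → ℝ) (Z : Fields) (N Nx x θ : ℝ) : metric μ Z N Nx x θ =
    !![-N ^ 2 + radial μ Z x * Nx ^ 2, radial μ Z x * Nx, 0, 0;
       radial μ Z x * Nx, radial μ Z x, 0, 0;
       0, 0, Z E1 x, 0;
       0, 0, 0, Z E1 x * Real.sin θ ^ 2] := by
  have : radial μ Z x = (Z E2 x) ^ 2 / (μ (jet k Z x) * Z E1 x) := by
    simp [radial, muS, jet, div_eq_mul_inv, mul_comm, mul_assoc]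
  rw [this]; rfl

theorem muS_ne_zero (hE1 : ∀ j ∈ U, 0 < j E1 0) (hE2 : ∀ j ∈ U, j E2 0 ≠ 0)
    (hμ0 : ∀ j ∈ U, μ j ≠ 0) {j : Jet k} (hj : j ∈ U) : muS μ j ≠ 0 :=
  mul_ne_zero (hμ0 j hj) (div_ne_zero (hE1 j hj).ne' (pow_ne_zero 2 (hE2 j hj)))

theorem hasDerivAt_radial_line (hX : IsOpen X) (hU : IsOpen U) (hE1 : ∀ j ∈ U, 0 < j E1 0)
    (hE2 : ∀ j ∈ U, j E2 0 ≠ 0) (hμ : ContDiffOn ℝ ∞ μ U) (hμ0 : ∀ j ∈ U, μ j ≠ 0)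
    (hZ : Z ∈ phaseSpace X U) (hA : SmoothFields X A) (hx : x ∈ X) :
    HasDerivAt (fun ε : ℝ => radial μ (Z + ε • A) x)
      (-(fderiv ℝ (muS μ) (jet k Z x) (jet k A x)) / muS μ (jet k Z x) ^ 2) 0 := by
  have h := (hasDerivAt_comp_jet_line hX hU (smooth_muS hE2 hμ) hZ hA hx).inv
    (by simpa using muS_ne_zero hE1 hE2 hμ0 (hZ.2 x hx))
  simp only [zero_smul, add_zero] at h
  exact h

theorem hasDerivAt_radial (hX : IsOpen X) (hU : IsOpen U) (hE1 : ∀ j ∈ U, 0 < j E1 0)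
    (hE2 : ∀ j ∈ U, j E2 0 ≠ 0) (hμ : ContDiffOn ℝ ∞ μ U) (hμ0 : ∀ j ∈ U, μ j ≠ 0)
    (hZ : Z ∈ phaseSpace X U) (hx : x ∈ X) :
    HasDerivAt (radial μ Z)
      (-(fderiv ℝ (muS μ) (jet k Z x) (jet k (derivFields Z) x)) / muS μ (jet k Z x) ^ 2) x :=
  (hasDerivAt_comp_jet hX hU (smooth_muS hE2 hμ) hZ hx).inv
    (muS_ne_zero hE1 hE2 hμ0 (hZ.2 x hx))

/-- Hamilton's equations at one instant hold on all of `X`, so they may be differentiated in `x`;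
the time derivative of the jet is then the jet of the Hamiltonian vector field. -/
theorem hasDerivAt_radial_history (hX : IsOpen X) (hU : IsOpen U) (hE1 : ∀ j ∈ U, 0 < j E1 0)
    (hE2 : ∀ j ∈ U, j E2 0 ≠ 0) (hμ : ContDiffOn ℝ ∞ μ U) (hμ0 : ∀ j ∈ U, μ j ≠ 0)
    {N Nx : ℝ → ℝ → ℝ} {Z : ℝ → Fields} {t : ℝ} (hZ : SolvesAt X G U H N Nx Z t) (hx : x ∈ X) :
    HasDerivAt (fun s => radial μ (Z s) x)
      (-(localBracket G (muS μ) (totalGrad G H (N t) (Nx t) (Z t)) (Z t) x) /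
        muS μ (jet k (Z t) x) ^ 2) t := by
  have hj := hZ.2.1.2 x hx
  have h1 := hasDerivAt_jet_history (k := k) (isOpen_univ.prod hX) hZ.1 (s := t) (x := x)
    ⟨Set.mem_univ _, hx⟩
  rw [jet_congr hX (B := hamVF G (totalGrad G H (N t) (Nx t) (Z t)))
    (fun v y hy => (hZ.2.2 v y hy).deriv) hx] at h1
  rw [localBracket_eq_fderiv]
  exact ((hasFDerivAt_of_smooth hU (smooth_muS hE2 hμ) hj).comp_hasDerivAt t h1).inv
    (muS_ne_zero hE1 hE2 hμ0 hj)

/-! ### Components of the Lie derivative of the metric along `α𝔑 + β`. -/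

section Components

variable (μ : Jet k → ℝ) (Z : ℝ → Fields) (N Nx α β : ℝ → ℝ → ℝ) (p : Fin 4 → ℝ)

theorem lieDeriv_metric_one_one :
    lieDeriv (gaugeVector Nx α β)
      (fun r => metric μ (Z (r 0)) (N (r 0) (r 1)) (Nx (r 0) (r 1)) (r 1) (r 2)) p 1 1 =
    α (p 0) (p 1) * deriv (fun s => radial μ (Z s) (p 1)) (p 0) +
      2 * (radial μ (Z (p 0)) (p 1) * Nx (p 0) (p 1) * deriv (α (p 0)) (p 1)) +
      (β (p 0) (p 1) - α (p 0) (p 1) * Nx (p 0) (p 1)) * deriv (radial μ (Z (p 0))) (p 1) +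
      2 * (radial μ (Z (p 0)) (p 1) *
        deriv (fun y => -(α (p 0) y * Nx (p 0) y) + β (p 0) y) (p 1)) := by
  simp [lieDeriv, Fin.sum_univ_four, gaugeVector, pd, metric_eq]
  ring

theorem lieDeriv_metric_two_two :
    lieDeriv (gaugeVector Nx α β)
      (fun r => metric μ (Z (r 0)) (N (r 0) (r 1)) (Nx (r 0) (r 1)) (r 1) (r 2)) p 2 2 =
    α (p 0) (p 1) * deriv (fun s => Z s E1 (p 1)) (p 0) +
      (β (p 0) (p 1) - α (p 0) (p 1) * Nx (p 0) (p 1)) * deriv (Z (p 0) E1) (p 1) := by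
  simp [lieDeriv, Fin.sum_univ_four, gaugeVector, pd, metric_eq]
  left; ring

theorem lieDeriv_metric_zero_zero :
    lieDeriv (gaugeVector Nx α β)
      (fun r => metric μ (Z (r 0)) (N (r 0) (r 1)) (Nx (r 0) (r 1)) (r 1) (r 2)) p 0 0 =
    α (p 0) (p 1) *
        deriv (fun s => -N s (p 1) ^ 2 + radial μ (Z s) (p 1) * Nx s (p 1) ^ 2) (p 0) +
      2 * ((-N (p 0) (p 1) ^ 2 + radial μ (Z (p 0)) (p 1) * Nx (p 0) (p 1) ^ 2) *
        deriv (fun s => α s (p 1)) (p 0)) +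
      (β (p 0) (p 1) - α (p 0) (p 1) * Nx (p 0) (p 1)) *
        deriv (fun y => -N (p 0) y ^ 2 + radial μ (Z (p 0)) y * Nx (p 0) y ^ 2) (p 1) +
      2 * (radial μ (Z (p 0)) (p 1) * Nx (p 0) (p 1) *
        deriv (fun s => -(α s (p 1) * Nx s (p 1)) + β s (p 1)) (p 0)) := by
  simp [lieDeriv, Fin.sum_univ_four, gaugeVector, pd, metric_eq]
  ring

theorem lieDeriv_metric_zero_one :
    lieDeriv (gaugeVector Nx α β)
      (fun r => metric μ (Z (r 0)) (N (r 0) (r 1)) (Nx (r 0) (r 1)) (r 1) (r 2)) p 0 1 =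
    α (p 0) (p 1) * deriv (fun s => radial μ (Z s) (p 1) * Nx s (p 1)) (p 0) +
      radial μ (Z (p 0)) (p 1) * Nx (p 0) (p 1) * deriv (fun s => α s (p 1)) (p 0) +
      (-N (p 0) (p 1) ^ 2 + radial μ (Z (p 0)) (p 1) * Nx (p 0) (p 1) ^ 2) *
        deriv (fun y => α (p 0) y) (p 1) +
      (β (p 0) (p 1) - α (p 0) (p 1) * Nx (p 0) (p 1)) *
        deriv (fun y => radial μ (Z (p 0)) y * Nx (p 0) y) (p 1) +
      radial μ (Z (p 0)) (p 1) *
        deriv (fun s => -(α s (p 1) * Nx s (p 1)) + β s (p 1)) (p 0) +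
      radial μ (Z (p 0)) (p 1) * Nx (p 0) (p 1) *
        deriv (fun y => -(α (p 0) y * Nx (p 0) y) + β (p 0) y) (p 1) := by
  simp [lieDeriv, Fin.sum_univ_four, gaugeVector, pd, metric_eq]
  ring

theorem lieDeriv_metric_three_three :
    lieDeriv (gaugeVector Nx α β)
      (fun r => metric μ (Z (r 0)) (N (r 0) (r 1)) (Nx (r 0) (r 1)) (r 1) (r 2)) p 3 3 =
    lieDeriv (gaugeVector Nx α β)
      (fun r => metric μ (Z (r 0)) (N (r 0) (r 1)) (Nx (r 0) (r 1)) (r 1) (r 2)) p 2 2 *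
      Real.sin (p 2) ^ 2 := by
  simp [lieDeriv, Fin.sum_univ_four, gaugeVector, pd, metric_eq]
  ring

theorem metric_symm (Z : Fields) (N Nx x θ : ℝ) (ρ σ : Fin 4) :
    metric μ Z N Nx x θ ρ σ = metric μ Z N Nx x θ σ ρ := by
  fin_cases ρ <;> fin_cases σ <;> rfl

theorem lieDeriv_metric_symm (ρ σ : Fin 4) :
    lieDeriv (gaugeVector Nx α β)
      (fun r => metric μ (Z (r 0)) (N (r 0) (r 1)) (Nx (r 0) (r 1)) (r 1) (r 2)) p ρ σ =
    lieDeriv (gaugeVector Nx α β)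
      (fun r => metric μ (Z (r 0)) (N (r 0) (r 1)) (Nx (r 0) (r 1)) (r 1) (r 2)) p σ ρ := by
  refine Finset.sum_congr rfl fun κ _ => ?_
  simp only [metric_symm μ _ _ _ _ _ ρ σ, metric_symm μ _ _ _ _ _ ρ κ,
    metric_symm μ _ _ _ _ _ κ σ]
  ring

end Components

end Metric

/-! ### Consequences of covariance -/

section Necessity

variable {k : ℕ} {X : Set ℝ} {U : Set (Jet k)} {H μ : Jet k → ℝ} {Z A : Fields} {G x : ℝ}
  {α N : ℝ → ℝ}

theorem totalGrad_zero (G : ℝ) (H : Jet k → ℝ) (N : ℝ → ℝ) (Z : Fields) :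
    totalGrad G H N (fun _ => 0) Z = grad H N Z := by
  funext v x
  have h : grad (diffeo k G) (fun _ => 0) Z v x = 0 := grad_eq_zero (Eventually.of_forall fun _ => rfl) v
  simp [totalGrad, h]

/-- With zero shift and `β = 0`, the spatial part of the vector field vanishes. The `θθ` and `xx`
components of the metric contain no lapse or shift, so `δN` and `δNx` drop out and only the action
of `H[αN]` on `E¹` and on `μS` is left. -/
theorem Covariant.static (hX : IsOpen X) (hU : IsOpen U) (hE1 : ∀ j ∈ U, 0 < j E1 0)
    (hE2 : ∀ j ∈ U, j E2 0 ≠ 0) (hH : ContDiffOn ℝ ∞ H U) (hμ : ContDiffOn ℝ ∞ μ U)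
    (hμ0 : ∀ j ∈ U, μ j ≠ 0) (hCov : Covariant X G U H μ) (hZ : Z ∈ phaseSpace X U)
    (hα : IsTest X α) (hN : ContDiffOn ℝ ∞ N X) (hN0 : ∀ x ∈ X, 0 < N x) (hx : x ∈ X) :
    hamVF G (grad H (fun y => α y * N y) Z) E1 x = α x * hamVF G (grad H N Z) E1 x ∧
    α x * localBracket G (muS μ) (grad H N Z) Z x =
      localBracket G (muS μ) (grad H (fun y => α y * N y) Z) Z x := by
  have hsN : SmoothOn X fun _ => N := hN.comp contDiff_snd.contDiffOn fun _ hp => hp.2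
  have hs0 : SmoothOn X fun _ _ => 0 := contDiffOn_const
  have hTα : IsTimeTest X fun _ => α := ⟨hα.1.comp contDiff_snd, tsupport α, hα.2.1, hα.2.2,
    fun _ _ h => image_eq_zero_of_notMem_tsupport h⟩
  have hT0 : IsTimeTest X fun _ _ => 0 := ⟨contDiff_const, ∅, isCompact_empty, by simp, by simp⟩
  obtain ⟨δN, δNx, -, h⟩ := hCov (fun _ => N) (fun _ _ => 0) (fun _ => α) (fun _ _ => 0) hsN
    (fun _ => hN0) hs0 hTα hT0
  set V : Fields := hamVF G (grad H N Z) with hV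
  have hVS : SmoothFields X V := smooth_hamVF (smooth_grad hX hU hH hZ hN)
  set W : Fields := hamVF G (grad H (fun y => α y * N y) Z) with hW
  have hWS : SmoothFields X W := smooth_hamVF (smooth_grad hX hU hH hZ (hα.smooth.mul hN))
  -- Hamilton's equations are required only at the instant `0`, so a straight line with the right
  -- velocity is an admissible history; no evolution problem has to be solved.
  have hsol : SolvesAt X G U H (fun _ => N) (fun _ _ => 0) (fun t => Z + t • V) 0 := by
    refine ⟨fun v => smooth_line (fun _ hp => hp.2) hZ.1 hVS v, by simpa using hZ, fun v y hy => ?_⟩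
    simp only [zero_smul, add_zero, totalGrad_zero]
    simpa using ((hasDerivAt_id (0 : ℝ)).mul_const (V v y)).const_add (Z v y)
  have h' := h (fun t => Z + t • V) ![0, x, 0, 0] (by simpa using hx) (by simpa using hsol)
  have h2 := (h' 2 2).congr_deriv
    (lieDeriv_metric_two_two μ (fun t => Z + t • V) (fun _ => N) (fun _ _ => 0) (fun _ => α)
      (fun _ _ => 0) ![0, x, 0, 0])
  have h1 := (h' 1 1).congr_deriv
    (lieDeriv_metric_one_one μ (fun t => Z + t • V) (fun _ => N) (fun _ _ => 0) (fun _ => α)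
      (fun _ _ => 0) ![0, x, 0, 0])
  simp only [metric_eq, totalGrad_zero] at h1 h2
  have hW1 : HasDerivAt (fun ε : ℝ => (Z + ε • W) E1 x) (W E1 x) 0 := by
    simpa using ((hasDerivAt_id (0 : ℝ)).mul_const (W E1 x)).const_add (Z E1 x)
  have hV1 : HasDerivAt (fun ε : ℝ => (Z + ε • V) E1 x) (V E1 x) 0 := by
    simpa using ((hasDerivAt_id (0 : ℝ)).mul_const (V E1 x)).const_add (Z E1 x)
  have hr := fun {A} (hA : SmoothFields X A) =>
    hasDerivAt_radial_line hX hU hE1 hE2 hμ hμ0 hZ hA hx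
  have hm := muS_ne_zero hE1 hE2 hμ0 (hZ.2 x hx)
  constructor
  · have e := hW1.unique (by simpa using h2)
    simpa [hV1.deriv] using e
  · have e := (hr hWS).unique (by simpa using h1)
    rw [(hr hVS).deriv] at e
    rw [localBracket_eq_fderiv, localBracket_eq_fderiv]
    field_simp at e
    linarith

/-- In the Leibniz expansion only the term with all `m` derivatives on the power survives at `x`. -/
theorem iteratedDeriv_sub_pow_mul {Q : ℝ → ℝ} {x : ℝ} (hQ : ContDiffAt ℝ ∞ Q x) {n m : ℕ}
    (hnm : n ≤ m) : iteratedDeriv n (fun y => (y - x) ^ m * Q y) x =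
      if n = m then m.factorial * Q x else 0 := by
  have hp : ∀ i, iteratedDeriv i (fun y => (y - x) ^ m) x = if i = m then (m.factorial : ℝ) else 0 := by
    intro i
    have := congrFun (iteratedDeriv_comp_sub_const i (fun y : ℝ => y ^ m) x) x
    rw [this, sub_self, iteratedDeriv_fun_pow_zero]
    split_ifs with h <;> simp
  rw [iteratedDeriv_fun_mul (by fun_prop) (hQ.of_le (by exact_mod_cast le_top))]
  simp only [hp]
  by_cases h : n = m
  · subst h
    rw [Finset.sum_eq_single n]
    · simp
    · intro i _ hi; simp [hi]
    · simp
  · rw [if_neg h]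
    refine Finset.sum_eq_zero fun i hi => ?_
    have : i ≠ m := by have := Finset.mem_range.1 hi; omega
    simp [this]

/-- The `θθ` condition makes `δH[α]/δK₁` vanish at every zero of `α`. A zero of order `m` at `x`
annihilates the orders below `m` there, the orders above `m` are already known to vanish on `X`, and
the order `m` contributes a nonzero multiple of its coefficient. -/
theorem Covariant.indepOfDerivK1 (hX : IsOpen X) (hU : IsOpen U) (hG : G ≠ 0)
    (hE1 : ∀ j ∈ U, 0 < j E1 0)
    (hE2 : ∀ j ∈ U, j E2 0 ≠ 0) (hH : ContDiffOn ℝ ∞ H U) (hμ : ContDiffOn ℝ ∞ μ U)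
    (hμ0 : ∀ j ∈ U, μ j ≠ 0) (hCov : Covariant X G U H μ) : IndepOfDerivK1 X U H := by
  intro Z hZ
  have hP := smooth_jetPartial_comp hX hU hH hZ K1
  have hall : ∀ α, IsTest X α → ∀ x ∈ X, α x = 0 → grad H α Z K1 x = 0 := fun α hα x hx h0 => by
    have := (hCov.static hX hU hE1 hE2 hH hμ hμ0 hZ hα contDiffOn_const (N := fun _ => 1)
      (fun _ _ => one_pos) hx).1
    simpa [h0, hamVF, coupling, hG] using this
  -- Descending induction on the order `m`, with `d` bounding the number of orders from `m` up to
  -- the top order `k + 1`; at `d = 0` there are none. The restriction `1 ≤ m` is what makes `α`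
  -- vanish at `x`.
  suffices h : ∀ d m : ℕ, 1 ≤ m → k + 2 ≤ m + d → ∀ n : Fin (k + 2), m ≤ n → ∀ x ∈ X,
      jetPartial H K1 n (jet k Z x) = 0 from
    fun x hx n hn => h (k + 1) 1 le_rfl (by omega) n hn x hx
  intro d
  induction d with
  | zero => intro m _ hm n hn; exact absurd n.2 (by omega)
  | succ d ih =>
    intro m hm hmd n hn x hx
    have ih' := ih (m + 1) (by omega) (by omega)
    obtain hlt | heq := hn.lt_or_eq
    · exact ih' n hlt x hx
    obtain ⟨φ, hφ, hφ1⟩ := exists_isTest_eventuallyEq_one hX isCompact_singleton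
      (Set.singleton_subset_iff.2 hx)
    have hφx : φ x = 1 := (hφ1 x rfl).self_of_nhds
    have hα : IsTest X fun y => (y - x) ^ m * φ y := hφ.smooth_mul hX (by fun_prop)
    have h0 := hall _ hα x hx (by simp; omega)
    rw [grad, Finset.sum_eq_single n] at h0
    · have e := iteratedDeriv_sub_pow_mul (n := n) (m := m)
        ((hφ.smooth.mul (hP n)).contDiffAt_of_isOpen hX hx) heq.symm.le
      simp only [← mul_assoc] at e
      rw [e, if_pos heq.symm] at h0
      simpa [hφx, Nat.factorial_ne_zero] using h0
    · intro n' _ hn'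
      obtain hlt | hge := lt_or_ge (n' : ℕ) m
      · have e := iteratedDeriv_sub_pow_mul (n := n') (m := m)
          ((hφ.smooth.mul (hP n')).contDiffAt_of_isOpen hX hx) hlt.le
        simp only [← mul_assoc] at e
        rw [e, if_neg hlt.ne, mul_zero]
      · have hn'' : m + 1 ≤ n' := by
          have : (n' : ℕ) ≠ n := fun h => hn' (Fin.ext h)
          omega
        -- The higher coefficients vanish at every point of `X`, not only at `x`; this is needed
        -- because they are differentiated here.
        have e : Set.EqOn (fun y => (y - x) ^ m * φ y * jetPartial H K1 n' (jet k Z y))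
            (fun _ => 0) X := fun y hy => by simp [ih' n' hn'' y hy]
        rw [iteratedDeriv_congr_on hX e n' hx]
        simp
    · simp

theorem localBracket_grad_congr {f : Jet k → ℝ} {N M : ℝ → ℝ} (h : N =ᶠ[𝓝 x] M) :
    localBracket G f (grad H N Z) Z x = localBracket G f (grad H M Z) Z x := by
  have hg : ∀ v, hamVF G (grad H N Z) v =ᶠ[𝓝 x] hamVF G (grad H M Z) v := fun v => by
    filter_upwards [eventually_eventually_nhds.2 h] with y hy
    cases v with
    | inl I => simp only [hamVF, grad_congr hy]
    | inr I => simp only [hamVF, grad_congr hy]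
  simp only [localBracket, fun v n => (hg v).iteratedDeriv_eq n]

theorem localBracket_grad_add (hX : IsOpen X) (hU : IsOpen U) (hH : ContDiffOn ℝ ∞ H U)
    (hZ : Z ∈ phaseSpace X U) {f : Jet k → ℝ} {N M : ℝ → ℝ} (hN : ContDiffOn ℝ ∞ N X)
    (hM : ContDiffOn ℝ ∞ M X) (hx : x ∈ X) :
    localBracket G f (grad H (fun y => N y + M y) Z) Z x =
      localBracket G f (grad H N Z) Z x + localBracket G f (grad H M Z) Z x := by
  have e : ∀ v, Set.EqOn (hamVF G (grad H (fun y => N y + M y) Z) v)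
      ((hamVF G (grad H N Z) + (1 : ℝ) • hamVF G (grad H M Z)) v) X := fun v y hy => by
    cases v with
    | inl I => simp only [hamVF, Pi.add_apply, Pi.smul_apply, grad_add hX hU hH hZ hN hM _ hy]; simp [mul_add]
    | inr I => simp only [hamVF, Pi.add_apply, Pi.smul_apply, grad_add hX hU hH hZ hN hM _ hy]; simp [mul_add]; ring
  rw [localBracket_eq_fderiv, jet_congr hX e hx, jet_add_smul hX
    (smooth_hamVF (smooth_grad hX hU hH hZ hN)) (smooth_hamVF (smooth_grad hX hU hH hZ hM)) 1 hx,
    one_smul, map_add, localBracket_eq_fderiv, localBracket_eq_fderiv]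

/-- Both sides are local in `α` and `N` and linear in `N`. Near `x` an arbitrary `N` is the
difference of the positive lapses `χ N + (C + 1)` and `C + 1`, where `C` bounds `|χ N|`. -/
theorem Covariant.structureFunctionCondition (hX : IsOpen X) (hU : IsOpen U)
    (hE1 : ∀ j ∈ U, 0 < j E1 0)
    (hE2 : ∀ j ∈ U, j E2 0 ≠ 0) (hH : ContDiffOn ℝ ∞ H U) (hμ : ContDiffOn ℝ ∞ μ U)
    (hμ0 : ∀ j ∈ U, μ j ≠ 0) (hCov : Covariant X G U H μ) :
    StructureFunctionCondition X G U H μ := by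
  intro Z hZ α N hα hN x hx
  obtain ⟨χ, hχ, hχ1⟩ := exists_isTest_eventuallyEq_one hX isCompact_singleton
    (Set.singleton_subset_iff.2 hx)
  replace hχ1 := hχ1 x rfl
  have hχα := hχ.mul_smooth hX hα
  have hχN := hχ.mul_smooth hX hN
  obtain ⟨C, hC⟩ := hχN.1.continuous.bounded_above_of_compact_support hχN.2.1
  have hC0 : 0 ≤ C := (norm_nonneg _).trans (hC 0)
  have hcst : ContDiffOn ℝ ∞ (fun _ : ℝ => C + 1) X := contDiffOn_const
  have e1 := (hCov.static hX hU hE1 hE2 hH hμ hμ0 hZ hχα (hχN.smooth.add hcst)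
    (fun y _ => by have := (abs_le.1 (hC y)).1; linarith) hx).2
  have e2 := (hCov.static hX hU hE1 hE2 hH hμ hμ0 hZ hχα hcst
    (fun y _ => by linarith) hx).2
  have e0 : (fun y => χ y * α y * (χ y * N y + (C + 1))) =
      fun y => χ y * α y * (χ y * N y) + χ y * α y * (C + 1) := funext fun y => mul_add _ _ _
  rw [e0] at e1
  rw [localBracket_grad_add hX hU hH hZ hχN.smooth hcst hx] at e1
  have e3 := localBracket_grad_add (G := G) (f := muS μ) hX hU hH hZ
    (hχα.smooth.mul hχN.smooth) (hχα.smooth.mul hcst) hx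
  rw [localBracket_grad_congr (N := fun y => χ y * α y * (χ y * N y)) (M := fun y => α y * N y)
    (by filter_upwards [hχ1] with y hy; rw [hy]; ring)] at e3
  rw [e3, localBracket_grad_congr (N := fun y => χ y * N y) (M := N)
    (by filter_upwards [hχ1] with y hy; rw [hy]; ring), ← e2, mul_add] at e1
  simpa [hχ1.self_of_nhds] using e1

end Necessity

/-! ### Sufficiency of the two conditions -/

/-! ### Time-dependent smearing functions and their time slices. -/

section TimeDependent

variable {X : Set ℝ} {f N : ℝ → ℝ → ℝ}

theorem SmoothOn.slice (hN : SmoothOn X N) (t : ℝ) : ContDiffOn ℝ ∞ (N t) X :=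
  hN.comp (f := fun x : ℝ => (t, x)) (by fun_prop) fun _ hx => ⟨Set.mem_univ _, hx⟩

theorem SmoothOn.hasDerivAt_time (hX : IsOpen X) (hN : SmoothOn X N) (t : ℝ) {x : ℝ}
    (hx : x ∈ X) : HasDerivAt (fun s => N s x) (deriv (fun s => N s x) t) t :=
  (hasDerivAt_fst (isOpen_univ.prod hX) hN ⟨Set.mem_univ _, hx⟩).differentiableAt.hasDerivAt

theorem IsTimeTest.slice (hf : IsTimeTest X f) (t : ℝ) : IsTest X (f t) := by
  obtain ⟨h, C, hC, hCX, h0⟩ := hf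
  have hs : tsupport (f t) ⊆ C := closure_minimal
    (fun x hx => by by_contra h; exact hx (h0 t x h)) hC.isClosed
  exact ⟨h.comp (f := fun x : ℝ => (t, x)) (by fun_prop),
    hC.of_isClosed_subset (isClosed_tsupport _) hs, hs.trans hCX⟩

theorem IsTimeTest.smoothOn (hf : IsTimeTest X f) : SmoothOn X f := hf.1.contDiffOn

theorem IsTimeTest.mul_smooth (hX : IsOpen X) (hf : IsTimeTest X f) (hN : SmoothOn X N) :
    IsTimeTest X fun t x => f t x * N t x := by
  have hsm := hf.smoothOn.mul hN
  obtain ⟨h, C, hC, hCX, h0⟩ := hf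
  refine ⟨contDiff_iff_contDiffAt.2 fun p => ?_, C, hC, hCX, fun t x hx => by simp [h0 t x hx]⟩
  by_cases hp : p.2 ∈ X
  · exact hsm.contDiffAt_of_isOpen (isOpen_univ.prod hX) ⟨Set.mem_univ _, hp⟩
  · have : (fun p : ℝ × ℝ => f p.1 p.2 * N p.1 p.2) =ᶠ[𝓝 p] fun _ => 0 := by
      filter_upwards [(hC.isClosed.isOpen_compl.preimage continuous_snd).mem_nhds
        (fun h => hp (hCX h))] with q hq
      simp [h0 q.1 q.2 hq]
    exact contDiffAt_const.congr_of_eventuallyEq this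

theorem IsTimeTest.deriv_time (hX : IsOpen X) (hf : IsTimeTest X f) (t : ℝ) :
    IsTest X fun x => deriv (fun s => f s x) t := by
  have hs := smooth_deriv_fst isOpen_univ (F := f) hf.1.contDiffOn
  obtain ⟨h, C, hC, hCX, h0⟩ := hf
  exact isTest_of_zero_off hX hC hCX
    (hs.comp (f := fun x : ℝ => (t, x)) (by fun_prop) fun x _ => Set.mem_univ _)
    fun x hx => by simp [h0 _ x hx]

end TimeDependent

section Sufficiency

variable {k : ℕ} {X : Set ℝ} {U : Set (Jet k)} {H μ : Jet k → ℝ} {Z : Fields} {G x : ℝ}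
  {a b M N : ℝ → ℝ}

theorem totalGrad_congr {a' b' : ℝ → ℝ} (ha : a =ᶠ[𝓝 x] a') (hb : b =ᶠ[𝓝 x] b') (v : Var) :
    totalGrad G H a b Z v x = totalGrad G H a' b' Z v x :=
  congrArg₂ (· + ·) (grad_congr ha v) (grad_congr hb v)

theorem smear_add (hX : IsOpen X) {f : Jet k → ℝ} (hf : ContDiffOn ℝ ∞ f U)
    (hZ : Z ∈ phaseSpace X U) (ha : IsTest X a) (hb : IsTest X b) :
    smear X f (fun x => a x + b x) Z = smear X f a Z + smear X f b Z := by
  have hs := smooth_comp_jet hX hf hZ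
  simp only [smear, mul_add]
  exact integral_add (ha.smooth_mul hX hs).integrableOn (hb.smooth_mul hX hs).integrableOn

theorem smear_sub (hX : IsOpen X) {f : Jet k → ℝ} (hf : ContDiffOn ℝ ∞ f U)
    (hZ : Z ∈ phaseSpace X U) (ha : IsTest X a) (hb : IsTest X b) :
    smear X f (fun x => a x - b x) Z = smear X f a Z - smear X f b Z := by
  have hs := smooth_comp_jet hX hf hZ
  simp only [smear, mul_sub]
  exact integral_sub (ha.smooth_mul hX hs).integrableOn (hb.smooth_mul hX hs).integrableOn

theorem smear_congr (hX : IsOpen X) {f : Jet k → ℝ} (h : Set.EqOn a b X) :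
    smear X f a Z = smear X f b Z :=
  setIntegral_congr_fun hX.measurableSet fun x hx => by simp only [h hx]

theorem bracket_totalGrad_of_isTest (hX : IsOpen X) (hU : IsOpen U)
    (hE2 : ∀ j ∈ U, j E2 0 ≠ 0) (hH : ContDiffOn ℝ ∞ H U) (hμ : ContDiffOn ℝ ∞ μ U)
    (hAlg : DeformedAlgebra X G U H μ) (hZ : Z ∈ phaseSpace X U)
    (ha : IsTest X a) (hb : IsTest X b) (hN : IsTest X N) (hM : IsTest X M) :
    bracket X G (totalGrad G H a b Z) (totalGrad G H N M Z) =
      smear X H (fun x => b x * deriv N x - M x * deriv a x) Z +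
      smear X (diffeo k G) (fun x => b x * deriv M x - M x * deriv b x +
        muS μ (jet k Z x) * (a x * deriv N x - N x * deriv a x)) Z := by
  have hd : ContDiffOn ℝ ∞ (diffeo k G) U := (contDiff_diffeo k G).contDiffOn
  have hm := smooth_comp_jet hX (smooth_muS hE2 hμ) hZ
  have gH : ∀ {N}, IsTest X N → ∀ v, IsTest X (grad H N Z v) := fun h => isTest_grad hX hU hH hZ h
  have gD : ∀ {N}, IsTest X N → ∀ v, IsTest X (grad (diffeo k G) N Z v) := fun h =>
    isTest_grad hX hU hd hZ h
  have gT : ∀ {N M}, IsTest X N → IsTest X M → SmoothFields X (totalGrad G H N M Z) :=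
    fun hN hM v => ((gH hN v).add hX (gD hM v)).smooth
  have hp : ∀ {N M}, IsTest X N → IsTest X M → IsTest X fun x => N x * deriv M x := fun hN hM =>
    hN.mul_smooth hX (hM.deriv hX).smooth
  have hS : ∀ {f : Fields}, (∀ v, IsTest X (f v)) → SmoothFields X f := fun h v => (h v).smooth
  rw [totalGrad, bracket_add_left hX (gH ha) (gD hb) (gT hN hM), bracket_swap (grad H a Z),
    bracket_swap (grad (diffeo k G) b Z), totalGrad,
    bracket_add_left hX (gH hN) (gD hM) (hS (gH ha)),
    bracket_add_left hX (gH hN) (gD hM) (hS (gD hb)),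
    bracket_swap (grad H N Z) (grad H a Z), bracket_swap (grad (diffeo k G) M Z) (grad H a Z),
    bracket_swap (grad (diffeo k G) M Z) (grad (diffeo k G) b Z),
    (hAlg Z hZ a N ha hN).2.2, (hAlg Z hZ a M ha hM).2.1, (hAlg Z hZ N b hN hb).2.1,
    (hAlg Z hZ b M hb hM).1, smear_sub hX hH hZ (hp hb hN) (hp hM ha),
    smear_add hX hd hZ ((hp hb hM).sub hX (hp hM hb))
      (((hp ha hN).sub hX (hp hN ha)).smooth_mul hX hm)]
  ring

/-- The algebra is only given for compactly supported smearing functions, while lapse and shift are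
not. A cutoff equal to one near the supports of `a` and `b` changes neither side, since every
integrand vanishes away from these supports. -/
theorem bracket_totalGrad (hX : IsOpen X) (hU : IsOpen U)
    (hE2 : ∀ j ∈ U, j E2 0 ≠ 0) (hH : ContDiffOn ℝ ∞ H U) (hμ : ContDiffOn ℝ ∞ μ U)
    (hAlg : DeformedAlgebra X G U H μ) (hZ : Z ∈ phaseSpace X U)
    (ha : IsTest X a) (hb : IsTest X b) (hN : ContDiffOn ℝ ∞ N X) (hM : ContDiffOn ℝ ∞ M X) :
    bracket X G (totalGrad G H a b Z) (totalGrad G H N M Z) =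
      smear X H (fun x => b x * deriv N x - M x * deriv a x) Z +
      smear X (diffeo k G) (fun x => b x * deriv M x - M x * deriv b x +
        muS μ (jet k Z x) * (a x * deriv N x - N x * deriv a x)) Z := by
  obtain ⟨χ, hχ, hχ1⟩ := exists_isTest_eventuallyEq_one hX (IsCompact.union ha.2.1 hb.2.1)
    (Set.union_subset ha.2.2 hb.2.2)
  have hg : ∀ (N : ℝ → ℝ), ∀ x ∈ tsupport a ∪ tsupport b,
      (fun y => χ y * N y) =ᶠ[𝓝 x] N := fun N x hx => by
    filter_upwards [hχ1 x hx] with y hy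
    rw [hy, one_mul]
  have hz : ∀ x, x ∉ tsupport a ∪ tsupport b →
      (a =ᶠ[𝓝 x] fun _ => 0) ∧ (b =ᶠ[𝓝 x] fun _ => 0) := fun x hx => by
    simp only [Set.mem_union, not_or] at hx
    exact ⟨notMem_tsupport_iff_eventuallyEq.1 hx.1, notMem_tsupport_iff_eventuallyEq.1 hx.2⟩
  have key := bracket_totalGrad_of_isTest hX hU hE2 hH hμ hAlg hZ ha hb
    (hχ.mul_smooth hX hN) (hχ.mul_smooth hX hM)
  have e1 : bracket X G (totalGrad G H a b Z) (totalGrad G H N M Z) =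
      bracket X G (totalGrad G H a b Z)
        (totalGrad G H (fun y => χ y * N y) (fun y => χ y * M y) Z) := by
    refine setIntegral_congr_fun hX.measurableSet fun x _ => Finset.sum_congr rfl fun I _ => ?_
    by_cases hx : x ∈ tsupport a ∪ tsupport b
    · simp only [totalGrad_congr (hg N x hx) (hg M x hx)]
    · have h0 : ∀ v, totalGrad G H a b Z v x = 0 := fun v => by
        simp [totalGrad, grad_eq_zero (hz x hx).1, grad_eq_zero (hz x hx).2]
      simp only [h0]
      ring
  rw [e1, key]
  have hz' : ∀ x, x ∉ tsupport a ∪ tsupport b →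
      a x = 0 ∧ b x = 0 ∧ deriv a x = 0 ∧ deriv b x = 0 := fun x hx => by
    have h := hz x hx
    exact ⟨h.1.self_of_nhds, h.2.self_of_nhds, by simp [h.1.deriv_eq], by simp [h.2.deriv_eq]⟩
  congr 1
  · refine smear_congr hX fun x _ => ?_
    by_cases hx : x ∈ tsupport a ∪ tsupport b
    · simp only [(hg N x hx).deriv_eq, (hg M x hx).self_of_nhds]
    · obtain ⟨h1, h2, h3, h4⟩ := hz' x hx
      simp only [h2, h3]; ring
  · refine smear_congr hX fun x _ => ?_
    by_cases hx : x ∈ tsupport a ∪ tsupport b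
    · simp only [(hg N x hx).deriv_eq, (hg M x hx).deriv_eq, (hg N x hx).self_of_nhds,
        (hg M x hx).self_of_nhds]
    · obtain ⟨h1, h2, h3, h4⟩ := hz' x hx
      simp only [h1, h2, h3, h4]; ring

theorem lieFields_congr {M' : ℝ → ℝ} (h : M =ᶠ[𝓝 x] M') (v : Var) :
    lieFields M Z v =ᶠ[𝓝 x] lieFields M' Z v := by
  have hd : ∀ v, deriv (fun y => M y * Z v y) =ᶠ[𝓝 x] deriv (fun y => M' y * Z v y) := fun v =>
    EventuallyEq.deriv (by filter_upwards [h] with y hy; rw [hy])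
  match v with
  | Sum.inl 0 => exact hd K1
  | Sum.inl 1 => filter_upwards [h] with y hy; simp only [lieFields, hy]
  | Sum.inr 0 => filter_upwards [h] with y hy; simp only [lieFields, hy]
  | Sum.inr 1 => exact hd E2

theorem smooth_lieFields (hX : IsOpen X) (hM : ContDiffOn ℝ ∞ M X) (hZ : SmoothFields X Z) :
    SmoothFields X (lieFields M Z) := fun v => by
  match v with
  | Sum.inl 0 => exact smooth_deriv hX (hM.mul (hZ _))
  | Sum.inl 1 => exact hM.mul (smooth_deriv hX (hZ _))
  | Sum.inr 0 => exact hM.mul (smooth_deriv hX (hZ _))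
  | Sum.inr 1 => exact smooth_deriv hX (hM.mul (hZ _))

theorem hamVF_totalGrad (hG : G ≠ 0) (H : Jet k → ℝ) (N M : ℝ → ℝ) (Z : Fields) :
    hamVF G (totalGrad G H N M Z) = hamVF G (grad H N Z) + (1 : ℝ) • lieFields M Z := by
  rw [← hamVF_grad_diffeo k hG Z M]
  funext v x
  cases v with
  | inl I => simp [hamVF, totalGrad, mul_add]
  | inr I => simp [hamVF, totalGrad, mul_add, add_comm]

/-- The jet at `x` only sees `M` near `x`, so the transformation law of `μS`, proved for compactly
supported `M`, extends to an arbitrary shift by a cutoff. -/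
theorem localBracket_muS_totalGrad (hX : IsOpen X) (hU : IsOpen U) (hG : G ≠ 0)
    (hE2 : ∀ j ∈ U, j E2 0 ≠ 0) (hH : ContDiffOn ℝ ∞ H U) (hμ : ContDiffOn ℝ ∞ μ U)
    (hAlg : DeformedAlgebra X G U H μ) (hZ : Z ∈ phaseSpace X U)
    (hN : ContDiffOn ℝ ∞ N X) (hM : ContDiffOn ℝ ∞ M X) (hx : x ∈ X) :
    localBracket G (muS μ) (totalGrad G H N M Z) Z x =
      localBracket G (muS μ) (grad H N Z) Z x +
        (M x * fderiv ℝ (muS μ) (jet k Z x) (jet k (derivFields Z) x) -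
          2 * deriv M x * muS μ (jet k Z x)) := by
  obtain ⟨χ, hχ, hχ1⟩ := exists_isTest_eventuallyEq_one hX isCompact_singleton
    (Set.singleton_subset_iff.2 hx)
  have hg : (fun y => χ y * M y) =ᶠ[𝓝 x] M := by
    filter_upwards [hχ1 x rfl] with y hy
    rw [hy, one_mul]
  have e : jet k (lieFields M Z) x = jet k (lieFields (fun y => χ y * M y) Z) x := by
    funext v n
    exact (lieFields_congr hg.symm v).iteratedDeriv_eq n
  have key := fderiv_muS_lieFields hX hU hG hE2 hH hμ hAlg hZ (hχ.mul_smooth hX hM) hx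
  have hgx : χ x * M x = M x := hg.self_of_nhds
  rw [← e, hg.deriv_eq, hgx] at key
  rw [localBracket_eq_fderiv, localBracket_eq_fderiv, hamVF_totalGrad hG,
    jet_add_smul hX (smooth_hamVF (smooth_grad hX hU hH hZ hN)) (smooth_lieFields hX hM hZ.1) 1 hx,
    one_smul, map_add, key]

/-- Under (i) only the undifferentiated term of the variational derivative survives, so `{E¹, H[N]}`
contains `N` without derivatives and replacing `N` by `αN` multiplies it by `α`. -/
theorem hamVF_grad_E1 (hX : IsOpen X) (hi : IndepOfDerivK1 X U H) (hZ : Z ∈ phaseSpace X U)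
    (N : ℝ → ℝ) (hx : x ∈ X) :
    hamVF G (grad H N Z) E1 x = -(2 * G * (N x * jetPartial H K1 0 (jet k Z x))) := by
  have : grad H N Z K1 x = N x * jetPartial H K1 0 (jet k Z x) := by
    rw [grad, Finset.sum_eq_single 0]
    · simp
    · intro n _ hn
      have hn' : 1 ≤ (n : ℕ) := Nat.one_le_iff_ne_zero.2 fun h => hn (Fin.ext h)
      have e : Set.EqOn (fun y => N y * jetPartial H K1 n (jet k Z y)) (fun _ => 0) X :=
        fun y hy => by simp [hi Z hZ y hy n hn']
      rw [iteratedDeriv_congr_on hX e n hx]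
      simp
    · simp
  simp [hamVF, coupling, this]

theorem covariant_of_conditions (hX : IsOpen X) (hU : IsOpen U) (hG : G ≠ 0)
    (hE1 : ∀ j ∈ U, 0 < j E1 0) (hE2 : ∀ j ∈ U, j E2 0 ≠ 0)
    (hH : ContDiffOn ℝ ∞ H U) (hμ : ContDiffOn ℝ ∞ μ U) (hμ0 : ∀ j ∈ U, μ j ≠ 0)
    (hAlg : DeformedAlgebra X G U H μ) (hi : IndepOfDerivK1 X U H)
    (hii : StructureFunctionCondition X G U H μ) : Covariant X G U H μ := by
  intro N Nx α β hN _ hNx hα hβ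
  have hd : ContDiffOn ℝ ∞ (diffeo k G) U := (contDiff_diffeo k G).contDiffOn
  have hαN := hα.mul_smooth hX hN
  -- The coefficients of `H` and of `H_x` in the expanded `∂_t Γ + {Γ, H[N] + H_x[Nˣ]}`. The shift
  -- variation depends on the configuration through `μS`.
  refine ⟨fun Z t x => deriv (fun s => α s x * N s x) t +
      (β t x * deriv (N t) x - Nx t x * deriv (fun y => α t y * N t y) x),
    fun Z t x => deriv (fun s => β s x) t +
      (β t x * deriv (Nx t) x - Nx t x * deriv (β t) x +
        muS μ (jet k Z x) * (α t x * N t x * deriv (N t) x -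
          N t x * deriv (fun y => α t y * N t y) x)), ?_, ?_⟩
  · intro Z hZ t
    have h1 := hαN.deriv_time hX t
    have h2 := ((hβ.slice t).mul_smooth hX (smooth_deriv hX (hN.slice t))).sub hX
      (((hαN.slice t).deriv hX).smooth_mul hX (hNx.slice t))
    have h3 := hβ.deriv_time hX t
    have h4 := (((hβ.slice t).mul_smooth hX (smooth_deriv hX (hNx.slice t))).sub hX
      (((hβ.slice t).deriv hX).smooth_mul hX (hNx.slice t))).add hX
      (IsTest.smooth_mul hX (((hαN.slice t).mul_smooth hX (smooth_deriv hX (hN.slice t))).sub hX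
        (((hαN.slice t).deriv hX).smooth_mul hX (hN.slice t)))
        (smooth_comp_jet hX (smooth_muS hE2 hμ) hZ))
    refine ⟨h1.add hX h2, h3.add hX h4, ?_⟩
    rw [smear_add hX hH hZ h1 h2, smear_add hX hd hZ h3 h4,
      bracket_totalGrad hX hU hE2 hH hμ hAlg hZ (hαN.slice t) (hβ.slice t) (hN.slice t)
        (hNx.slice t)]
    ring
  · intro Z p hp hsol
    have hZ := hsol.2.1
    have hm0 := muS_ne_zero hE1 hE2 hμ0 (hZ.2 _ hp)
    have hW : SmoothFields X (hamVF G (totalGrad G H (fun x => α (p 0) x * N (p 0) x) (β (p 0))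
        (Z (p 0)))) := by
      rw [hamVF_totalGrad hG]
      exact SmoothFields.add_smul (smooth_hamVF (smooth_grad hX hU hH hZ (hαN.slice _).smooth))
        (smooth_lieFields hX (hβ.slice _).smooth hZ.1) 1
    have hr := hasDerivAt_radial_line hX hU hE1 hE2 hμ hμ0 hZ hW hp
    -- Condition (ii) enters here: the part of the variation of `μS` due to `H[αN]` becomes `α`
    -- times the part of its time derivative due to `H[N]`.
    rw [← localBracket_eq_fderiv, localBracket_muS_totalGrad hX hU hG hE2 hH hμ hAlg hZ
      (hαN.slice _).smooth (hβ.slice _).smooth hp, ← hii _ hZ _ _ (hα.slice _).smooth (hN.slice _)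
      _ hp] at hr
    have hrt := hasDerivAt_radial_history hX hU hE1 hE2 hμ hμ0 hsol hp
    rw [localBracket_muS_totalGrad hX hU hG hE2 hH hμ hAlg hZ (hN.slice _) (hNx.slice _) hp] at hrt
    have hrx := hasDerivAt_radial hX hU hE1 hE2 hμ hμ0 hZ hp
    have dE : HasDerivAt (fun ε : ℝ => (Z (p 0) + ε • hamVF G (totalGrad G H
        (fun x => α (p 0) x * N (p 0) x) (β (p 0)) (Z (p 0)))) E1 (p 1))
        (hamVF G (totalGrad G H (fun x => α (p 0) x * N (p 0) x) (β (p 0)) (Z (p 0))) E1 (p 1))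
        0 := by
      simpa using ((hasDerivAt_id (0 : ℝ)).mul_const (hamVF G (totalGrad G H
        (fun x => α (p 0) x * N (p 0) x) (β (p 0)) (Z (p 0))) E1 (p 1))).const_add (Z (p 0) E1 (p 1))
    have dNt := hN.hasDerivAt_time hX (p 0) hp
    have dNxt := hNx.hasDerivAt_time hX (p 0) hp
    have dαt := hα.smoothOn.hasDerivAt_time hX (p 0) hp
    have dβt := hβ.smoothOn.hasDerivAt_time hX (p 0) hp
    have dN := hasDerivAt_of_smooth hX (hN.slice (p 0)) hp
    have dNx := hasDerivAt_of_smooth hX (hNx.slice (p 0)) hp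
    have dα := hasDerivAt_of_smooth hX (hα.slice (p 0)).smooth hp
    have dβ := hasDerivAt_of_smooth hX (hβ.slice (p 0)).smooth hp
    have eN := (dαt.fun_mul dNt).deriv
    have eN' := (dα.fun_mul dN).deriv
    have eξt := ((dαt.fun_mul dNxt).fun_neg.fun_add dβt).deriv
    have eξ := ((dα.fun_mul dNx).fun_neg.fun_add dβ).deriv
    simp only [eN, eN']
    set δN : ℝ := deriv (fun s => α s (p 1)) (p 0) * N (p 0) (p 1) +
      α (p 0) (p 1) * deriv (fun s => N s (p 1)) (p 0) + (β (p 0) (p 1) * deriv (N (p 0)) (p 1) -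
        Nx (p 0) (p 1) * (deriv (α (p 0)) (p 1) * N (p 0) (p 1) +
          α (p 0) (p 1) * deriv (N (p 0)) (p 1))) with hδN
    set δNx : ℝ := deriv (fun s => β s (p 1)) (p 0) + (β (p 0) (p 1) * deriv (Nx (p 0)) (p 1) -
      Nx (p 0) (p 1) * deriv (β (p 0)) (p 1) + muS μ (jet k (Z (p 0)) (p 1)) *
        (α (p 0) (p 1) * N (p 0) (p 1) * deriv (N (p 0)) (p 1) - N (p 0) (p 1) *
          (deriv (α (p 0)) (p 1) * N (p 0) (p 1) + α (p 0) (p 1) * deriv (N (p 0)) (p 1)))) with hδNx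
    have dδN : HasDerivAt (fun ε : ℝ => N (p 0) (p 1) + ε * δN) δN 0 := by
      simpa using ((hasDerivAt_id (0 : ℝ)).mul_const δN).const_add (N (p 0) (p 1))
    have dδNx : HasDerivAt (fun ε : ℝ => Nx (p 0) (p 1) + ε * δNx) δNx 0 := by
      simpa using ((hasDerivAt_id (0 : ℝ)).mul_const δNx).const_add (Nx (p 0) (p 1))
    have hrad : radial μ (Z (p 0)) (p 1) = (muS μ (jet k (Z (p 0)) (p 1)))⁻¹ := rfl
    have c00 : HasDerivAt (fun ε : ℝ => metric μ (Z (p 0) + ε • hamVF G (totalGrad G H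
        (fun x => α (p 0) x * N (p 0) x) (β (p 0)) (Z (p 0)))) (N (p 0) (p 1) + ε * δN)
        (Nx (p 0) (p 1) + ε * δNx) (p 1) (p 2) 0 0) (lieDeriv (gaugeVector Nx α β)
        (fun r => metric μ (Z (r 0)) (N (r 0) (r 1)) (Nx (r 0) (r 1)) (r 1) (r 2)) p 0 0) 0 := by
      rw [lieDeriv_metric_zero_zero]
      simp only [metric_eq]
      refine HasDerivAt.congr_deriv ((dδN.fun_pow 2).fun_neg.fun_add
        (hr.fun_mul (dδNx.fun_pow 2))) ?_
      rw [eξt,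
        ((dNt.fun_pow 2).fun_neg.fun_add (hrt.fun_mul (dNxt.fun_pow 2))).deriv,
        ((dN.fun_pow 2).fun_neg.fun_add (hrx.fun_mul (dNx.fun_pow 2))).deriv]
      simp only [zero_smul, zero_mul, add_zero, hrad, hδN, hδNx, Nat.cast_ofNat]
      field_simp
      ring
    have c01 : HasDerivAt (fun ε : ℝ => metric μ (Z (p 0) + ε • hamVF G (totalGrad G H
        (fun x => α (p 0) x * N (p 0) x) (β (p 0)) (Z (p 0)))) (N (p 0) (p 1) + ε * δN)
        (Nx (p 0) (p 1) + ε * δNx) (p 1) (p 2) 0 1) (lieDeriv (gaugeVector Nx α β)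
        (fun r => metric μ (Z (r 0)) (N (r 0) (r 1)) (Nx (r 0) (r 1)) (r 1) (r 2)) p 0 1) 0 := by
      rw [lieDeriv_metric_zero_one]
      simp only [metric_eq]
      refine HasDerivAt.congr_deriv (hr.fun_mul dδNx) ?_
      rw [eξt, eξ, (hrt.fun_mul dNxt).deriv, (hrx.fun_mul dNx).deriv]
      -- Since `g_xx` is the inverse of `μS`, the term `-μS N² ∂_x α` of the shift variation yields
      -- the `-N² ∂_x α` of the Lie derivative.
      simp only [zero_smul, zero_mul, add_zero, hrad, hδNx]
      field_simp
      ring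
    have c11 : HasDerivAt (fun ε : ℝ => metric μ (Z (p 0) + ε • hamVF G (totalGrad G H
        (fun x => α (p 0) x * N (p 0) x) (β (p 0)) (Z (p 0)))) (N (p 0) (p 1) + ε * δN)
        (Nx (p 0) (p 1) + ε * δNx) (p 1) (p 2) 1 1) (lieDeriv (gaugeVector Nx α β)
        (fun r => metric μ (Z (r 0)) (N (r 0) (r 1)) (Nx (r 0) (r 1)) (r 1) (r 2)) p 1 1) 0 := by
      rw [lieDeriv_metric_one_one]
      simp only [metric_eq]
      refine HasDerivAt.congr_deriv hr ?_
      rw [eξ, hrt.deriv, hrx.deriv, hrad]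
      field_simp
      ring
    have c22 : HasDerivAt (fun ε : ℝ => (Z (p 0) + ε • hamVF G (totalGrad G H
        (fun x => α (p 0) x * N (p 0) x) (β (p 0)) (Z (p 0)))) E1 (p 1)) (lieDeriv (gaugeVector Nx α β)
        (fun r => metric μ (Z (r 0)) (N (r 0) (r 1)) (Nx (r 0) (r 1)) (r 1) (r 2)) p 2 2) 0 := by
      refine dE.congr_deriv ?_
      -- Condition (i) enters in this component, through `hamVF_grad_E1`; the shift part of the time
      -- derivative cancels the `-α Nˣ ∂_x E¹` coming from `α𝔑`.
      rw [lieDeriv_metric_two_two, (hsol.2.2 E1 _ hp).deriv, hamVF_totalGrad hG,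
        hamVF_totalGrad hG]
      simp only [Pi.add_apply, Pi.smul_apply, hamVF_grad_E1 hX hi hZ _ hp, lieFields, smul_eq_mul]
      ring
    have c10 := c01
    simp only [metric_symm μ _ _ _ _ _ 0 1] at c10
    rw [lieDeriv_metric_symm] at c10
    have hz : ∀ ρ σ, (∀ (Z : Fields) (N Nx x θ : ℝ), metric μ Z N Nx x θ ρ σ = 0) →
        lieDeriv (gaugeVector Nx α β)
          (fun r => metric μ (Z (r 0)) (N (r 0) (r 1)) (Nx (r 0) (r 1)) (r 1) (r 2)) p ρ σ = 0 →
        HasDerivAt (fun ε : ℝ => metric μ (Z (p 0) + ε • hamVF G (totalGrad G H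
          (fun x => α (p 0) x * N (p 0) x) (β (p 0)) (Z (p 0)))) (N (p 0) (p 1) + ε * δN)
          (Nx (p 0) (p 1) + ε * δNx) (p 1) (p 2) ρ σ) (lieDeriv (gaugeVector Nx α β)
          (fun r => metric μ (Z (r 0)) (N (r 0) (r 1)) (Nx (r 0) (r 1)) (r 1) (r 2)) p ρ σ) 0 :=
      fun ρ σ h1 h2 => by
        simp only [h1] at h2 ⊢
        rw [h2]
        exact hasDerivAt_const 0 0
    have c33 := (c22.mul_const (Real.sin (p 2) ^ 2)).congr_deriv
      (lieDeriv_metric_three_three μ Z N Nx α β p).symm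
    intro ρ σ
    fin_cases ρ <;> fin_cases σ <;>
      first
      | exact hz _ _ (fun _ _ _ _ _ => rfl) (by
          simp [lieDeriv, Fin.sum_univ_four, gaugeVector, pd, metric_eq])
      | exact c00
      | exact c01
      | exact c10
      | exact c11
      | exact c22
      | exact c33

end Sufficiency

end SphSym

end

theorem mainTheorem1 (k : ℕ) (X : Set ℝ) (hX : IsOpen X) (G : ℝ) (hG : 0 < G)
    (U : Set (SphSym.Jet k)) (hU : IsOpen U)
    (hE1 : ∀ j ∈ U, 0 < j SphSym.E1 0) (hE2 : ∀ j ∈ U, j SphSym.E2 0 ≠ 0)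
    (H μ : SphSym.Jet k → ℝ) (hH : ContDiffOn ℝ (⊤ : ℕ∞) H U) (hμ : ContDiffOn ℝ (⊤ : ℕ∞) μ U)
    (hμ0 : ∀ j ∈ U, μ j ≠ 0)
    (hAlg : SphSym.DeformedAlgebra X G U H μ) :
    SphSym.Covariant X G U H μ ↔
      (SphSym.IndepOfDerivK1 X U H ∧ SphSym.StructureFunctionCondition X G U H μ) :=
  ⟨fun h => ⟨h.indepOfDerivK1 hX hU hG.ne' hE1 hE2 hH hμ hμ0,
    h.structureFunctionCondition hX hU hE1 hE2 hH hμ hμ0⟩,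
    fun h => SphSym.covariant_of_conditions hX hU hG.ne' hE1 hE2 hH hμ hμ0 hAlg h.1 h.2⟩
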